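/- Let $\hbar>0$, $m>0$, $\ell\ge 0$, $\omega_->0$, $\omega_+>0$, with $\omega_-\neq\omega_+$ if $\ell=0$. Let $P_\hbar$ be the Schrödinger operator $$P_\hbar=-\frac{\hbar^2}{2m}\frac{d^2}{dx^2}+V(x),\qquad V(x)=\begin{cases}\tfrac12 m\omega_-^2x^2,& x<0,\\ 0,& 0\le x\le \ell,\\ \tfrac12 m\omega_+^2(x-\ell)^2,& x>\ell,\end{cases}$$ in $L^2(\mathbb R)=L^2(\mathbb R;\mathbb C)$, with its maximal domain: all $u\in L^2(\mathbb R)$ such that $u$ and $u'$ are locally absolutely continuous and $-\frac{\hbar^2}{2m}u''+Vu\in L^2(\mathbb R)$. Let $\tilde\theta:[0,\infty)\to\mathbb R$ be the unique continuous function with $\tilde\theta(0)=-\pi/2$ such that for every $z\ge 0$ there is $\tilde r(z)>0$ with $$\tilde r(z)\cos\tilde\theta(z)=\frac{z^{1/2}}{\Gamma(3/4-z)},\qquad \tilde r(z)\sin\tilde\theta(z)=-\frac{1}{\Gamma(1/4-z)},$$ where $1/\Gamma$ is the entire function that vanishes at the poles of $\Gamma$. Then the following hold. 1. A complex number $E$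 is an eigenvalue of $P_\hbar$ if and only if $E$ is real, $E>0$, and $$\frac{\sqrt{2m}\,\ell\sqrt{E}}{\hbar}+\tilde\theta\Big(\frac{E}{2\hbar\omega_-}\Big)+\tilde\theta\Big(\frac{E}{2\hbar\omega_+}\Big)\in\pi\mathbb Z.$$ 2. Every eigenvalue of $P_\hbar$ is simple, i.e. its eigenspace has complex dimension one. 3. The eigenvalues of $P_\hbar$ can be listed as a strictly increasing sequence $E_{0;\hbar}<E_{1;\hbar}<E_{2;\hbar}<\cdots$, and for this list $$\frac{\sqrt{2m}\,\ell\sqrt{E_{n;\hbar}}}{\hbar}+\tilde\theta\Big(\frac{E_{n;\hbar}}{2\hbar\omega_-}\Big)+\tilde\theta\Big(\frac{E_{n;\hbar}}{2\hbar\omega_+}\Big)=\pi n\qquad\text{for all } n\ge 0.$$ -/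

import Mathlib

open MeasureTheory Set

/-- The potential: a half parabola of frequency `ωm` on the left of `0`, flat on `[0, ℓ]`, and a half
parabola of frequency `ωp` on the right of `ℓ`. -/
noncomputable def bathtubPotential (m ℓ ωm ωp : ℝ) (x : ℝ) : ℝ :=
  if x < 0 then 1 / 2 * m * ωm ^ 2 * x ^ 2
  else if x ≤ ℓ then 0
  else 1 / 2 * m * ωp ^ 2 * (x - ℓ) ^ 2

/-- The complex Hilbert space `L²(ℝ)`. -/
abbrev L2R : Type := Lp ℂ 2 (volume : Measure ℝ)

/-- `SecondDeriv v g` : the function `v` is differentiable, `v'` is locally absolutely continuous,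
and `g` is (almost everywhere) its derivative `v''`. -/
def SecondDeriv (v g : ℝ → ℂ) : Prop :=
  Differentiable ℝ v ∧ LocallyIntegrable g volume ∧
    ∀ a b : ℝ, deriv v b - deriv v a = ∫ x in a..b, g x

theorem SecondDeriv.add {v₁ g₁ v₂ g₂ : ℝ → ℂ} (h₁ : SecondDeriv v₁ g₁) (h₂ : SecondDeriv v₂ g₂) :
    SecondDeriv (v₁ + v₂) (g₁ + g₂) := by
  refine ⟨h₁.1.add h₂.1, h₁.2.1.add h₂.2.1, fun a b => ?_⟩
  have hi₁ : IntervalIntegrable g₁ volume a b :=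
    (h₁.2.1.integrableOn_isCompact isCompact_uIcc).intervalIntegrable
  have hi₂ : IntervalIntegrable g₂ volume a b :=
    (h₂.2.1.integrableOn_isCompact isCompact_uIcc).intervalIntegrable
  simp only [Pi.add_apply]
  rw [intervalIntegral.integral_add hi₁ hi₂, ← h₁.2.2, ← h₂.2.2,
    deriv_add (h₁.1 _) (h₂.1 _), deriv_add (h₁.1 _) (h₂.1 _)]
  ring

theorem SecondDeriv.smul {v g : ℝ → ℂ} (c : ℂ) (h : SecondDeriv v g) :
    SecondDeriv (c • v) (c • g) := by
  refine ⟨h.1.const_smul c, h.2.1.smul c, fun a b => ?_⟩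
  simp only [Pi.smul_apply]
  rw [intervalIntegral.integral_smul, ← h.2.2, deriv_const_smul c (h.1 _),
    deriv_const_smul c (h.1 _), smul_sub]

theorem SecondDeriv.ae_eq {v g : ℝ → ℂ} (h : SecondDeriv v g) :
    g =ᵐ[volume] deriv (deriv v) := by
  filter_upwards [LocallyIntegrable.ae_hasDerivAt_integral h.2.1] with x hx
  have h1 : deriv v = fun y => (∫ t in (0 : ℝ)..y, g t) + deriv v 0 := by
    funext y
    rw [← h.2.2 0 y]
    ring
  rw [h1]
  exact ((hx 0).add_const _).deriv.symm

/-- The graph of the Schrödinger operator `-(h² / 2m) d²/dx² + V` on its maximal domain in `L²(ℝ)`: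
the pairs `(u, f)` such that `u` is represented by a function `v` with `v` and `v'` locally
absolutely continuous, and `f = -(h² / 2m) v'' + V v` almost everywhere. -/
noncomputable def schrodingerGraph (h m : ℝ) (V : ℝ → ℝ) : Submodule ℂ (L2R × L2R) where
  carrier := {p | ∃ v g : ℝ → ℂ, SecondDeriv v g ∧ (p.1 : ℝ → ℂ) =ᵐ[volume] v ∧
    (p.2 : ℝ → ℂ) =ᵐ[volume] fun x => -((h ^ 2 / (2 * m) : ℝ) : ℂ) * g x + (V x : ℂ) * v x}
  add_mem' := by
    rintro p q ⟨v₁, g₁, hs₁, hv₁, hg₁⟩ ⟨v₂, g₂, hs₂, hv₂, hg₂⟩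
    refine ⟨v₁ + v₂, g₁ + g₂, hs₁.add hs₂, ?_, ?_⟩
    · filter_upwards [Lp.coeFn_add p.1 q.1, hv₁, hv₂] with x hx h1 h2
      simp only [Prod.fst_add, hx, Pi.add_apply, h1, h2]
    · filter_upwards [Lp.coeFn_add p.2 q.2, hg₁, hg₂] with x hx h1 h2
      simp only [Prod.snd_add, hx, Pi.add_apply, h1, h2]
      ring
  zero_mem' := by
    refine ⟨0, 0, ⟨differentiable_const 0, locallyIntegrable_zero, fun a b => ?_⟩, ?_, ?_⟩
    · simp
    · exact Lp.coeFn_zero ℂ 2 volume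
    · filter_upwards [Lp.coeFn_zero ℂ 2 (volume : Measure ℝ)] with x hx
      exact hx.trans (by simp)
  smul_mem' := by
    rintro c p ⟨v, g, hs, hv, hg⟩
    refine ⟨c • v, c • g, hs.smul c, ?_, ?_⟩
    · filter_upwards [Lp.coeFn_smul c p.1, hv] with x hx h1
      simp only [Prod.smul_fst, hx, Pi.smul_apply, h1]
    · filter_upwards [Lp.coeFn_smul c p.2, hg] with x hx h1
      simp only [Prod.smul_snd, hx, Pi.smul_apply, h1, smul_eq_mul]
      ring

theorem schrodingerGraph_functional (h m : ℝ) (V : ℝ → ℝ) (p : L2R × L2R)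
    (hp : p ∈ schrodingerGraph h m V) (h0 : p.1 = 0) : p.2 = 0 := by
  obtain ⟨v, g, hs, hv, hg⟩ := hp
  have hv0 : v = 0 := by
    have : v =ᵐ[volume] (0 : ℝ → ℂ) := by
      rw [h0] at hv
      exact hv.symm.trans (Lp.coeFn_zero ℂ 2 volume)
    exact (Continuous.ae_eq_iff_eq volume hs.1.continuous continuous_zero).1 this
  have hg0 := hs.ae_eq
  apply Lp.ext
  filter_upwards [hg, hg0, Lp.coeFn_zero ℂ 2 (volume : Measure ℝ)] with x h1 h2 h3
  rw [h1, h2, h3, hv0]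
  have h4 : deriv (0 : ℝ → ℂ) = 0 := by
    funext y
    exact deriv_const y (0 : ℂ)
  simp [h4]

/-- The Schrödinger operator `-(h² / 2m) d²/dx² + V`, an unbounded operator in `L²(ℝ)` with its
maximal domain. -/
noncomputable def schrodingerOp (h m : ℝ) (V : ℝ → ℝ) : L2R →ₗ.[ℂ] L2R :=
  (schrodingerGraph h m V).toLinearPMap

theorem schrodingerOp_graph (h m : ℝ) (V : ℝ → ℝ) :
    (schrodingerOp h m V).graph = schrodingerGraph h m V :=
  Submodule.toLinearPMap_graph_eq _ (schrodingerGraph_functional h m V)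

/-- The Schrödinger operator with the piecewise quadratic / flat potential. -/
noncomputable def bathtubOp (h m ℓ ωm ωp : ℝ) : L2R →ₗ.[ℂ] L2R :=
  schrodingerOp h m (bathtubPotential m ℓ ωm ωp)

/-- The eigenspace `{u ∈ dom A | A u = E u}` of an unbounded operator. -/
def unboundedEigenspace {H : Type*} [AddCommGroup H] [Module ℂ H] (A : H →ₗ.[ℂ] H) (E : ℂ) :
    Submodule ℂ H where
  carrier := {u | ∃ w : A.domain, (w : H) = u ∧ A w = E • u}
  add_mem' := by
    rintro _ _ ⟨a, rfl, ha⟩ ⟨b, rfl, hb⟩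
    exact ⟨a + b, rfl, by rw [A.map_add, ha, hb, smul_add]⟩
  zero_mem' := ⟨0, rfl, by rw [A.map_zero, smul_zero]⟩
  smul_mem' := by
    rintro c _ ⟨a, rfl, ha⟩
    exact ⟨c • a, rfl, by rw [A.map_smul, ha, smul_comm]⟩

/-- `E` is an eigenvalue of the unbounded operator `A`. -/
def IsUnboundedEigenvalue {H : Type*} [AddCommGroup H] [Module ℂ H] (A : H →ₗ.[ℂ] H) (E : ℂ) :
    Prop :=
  ∃ u : A.domain, (u : H) ≠ 0 ∧ A u = E • (u : H)

/-- `θ` is a continuous angle, normalized by `θ 0 = -π/2`, of the planar curve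
`z ↦ (z^{1/2} / Γ(3/4 - z), -1 / Γ(1/4 - z))`, `z ≥ 0`. At a pole of `Γ` the function `Real.Gamma`
vanishes, so that the quotient is `0` there, the value of the entire function `1 / Γ`. -/
def IsAngleFunction (θ : ℝ → ℝ) : Prop :=
  ContinuousOn θ (Ici 0) ∧ θ 0 = -(Real.pi / 2) ∧
    ∀ z : ℝ, 0 ≤ z → ∃ r : ℝ, 0 < r ∧
      r * Real.cos (θ z) = Real.sqrt z / Real.Gamma (3 / 4 - z) ∧
      r * Real.sin (θ z) = -(1 / Real.Gamma (1 / 4 - z))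

theorem one_div_Gamma_reflect (s : ℝ) (hs : 0 < s) :
    1 / Real.Gamma (1 - s) = Real.Gamma s * Real.sin (Real.pi * s) / Real.pi := by
  have h1 := Real.Gamma_mul_Gamma_one_sub s
  have h2 : Real.Gamma s ≠ 0 := (Real.Gamma_pos_of_pos hs).ne'
  have hpi := Real.pi_ne_zero
  by_cases h3 : Real.sin (Real.pi * s) = 0
  · rw [h3, div_zero] at h1
    have h4 : Real.Gamma (1 - s) = 0 := by
      rcases mul_eq_zero.1 h1 with h | h
      · exact absurd h h2
      · exact h
    rw [h4, h3]
    simp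
  · have h4 : Real.Gamma (1 - s) ≠ 0 := by
      intro h
      rw [h, mul_zero] at h1
      exact (div_ne_zero hpi h3) h1.symm
    rw [div_eq_div_iff h4 hpi, one_mul]
    rw [eq_div_iff h3] at h1
    linarith

theorem exists_isAngleFunction : ∃ θ : ℝ → ℝ, IsAngleFunction θ := by
  -- In the frame rotated by `π (z - 1/4)`, the curve stays in the right half plane.
  let t : ℝ → ℝ := fun z => Real.pi * (z - 1 / 4)
  let A : ℝ → ℝ := fun z => Real.sqrt z * Real.Gamma (1 / 4 + z) / Real.pi
  let B : ℝ → ℝ := fun z => Real.Gamma (3 / 4 + z) / Real.pi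
  let P : ℝ → ℝ := fun z => A z * Real.cos (t z) ^ 2 + B z * Real.sin (t z) ^ 2
  let Q : ℝ → ℝ := fun z => (B z - A z) * (Real.sin (t z) * Real.cos (t z))
  have hx : ∀ z : ℝ, 0 ≤ z → Real.sqrt z / Real.Gamma (3 / 4 - z) = A z * Real.cos (t z) := by
    intro z hz
    have h := one_div_Gamma_reflect (1 / 4 + z) (by linarith)
    rw [show (1 : ℝ) - (1 / 4 + z) = 3 / 4 - z by ring] at h
    rw [show Real.pi * (1 / 4 + z) = t z + Real.pi / 2 by simp only [t]; ring,
      Real.sin_add_pi_div_two] at h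
    rw [div_eq_mul_one_div, h]
    simp only [A]
    ring
  have hy : ∀ z : ℝ, 0 ≤ z → -(1 / Real.Gamma (1 / 4 - z)) = B z * Real.sin (t z) := by
    intro z hz
    have h := one_div_Gamma_reflect (3 / 4 + z) (by linarith)
    rw [show (1 : ℝ) - (3 / 4 + z) = 1 / 4 - z by ring] at h
    rw [show Real.pi * (3 / 4 + z) = t z + Real.pi by simp only [t]; ring,
      Real.sin_add_pi] at h
    rw [h]
    simp only [B]
    ring
  have hB : ∀ z : ℝ, 0 ≤ z → 0 < B z := fun z hz =>
    div_pos (Real.Gamma_pos_of_pos (by linarith)) Real.pi_pos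
  have hA : ∀ z : ℝ, 0 < z → 0 < A z := fun z hz =>
    div_pos (mul_pos (Real.sqrt_pos.2 hz) (Real.Gamma_pos_of_pos (by linarith))) Real.pi_pos
  have ht0 : t 0 = -(Real.pi / 4) := by simp only [t]; ring
  have hA0 : A 0 = 0 := by simp [A]
  have hP : ∀ z : ℝ, 0 ≤ z → 0 < P z := by
    intro z hz
    rcases hz.eq_or_lt with h | h
    · subst h
      have hs : Real.sin (t 0) ≠ 0 := by
        rw [ht0, Real.sin_neg, Real.sin_pi_div_four]
        simp
      have h1 : 0 < Real.sin (t 0) ^ 2 := by positivity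
      have h2 := mul_pos (hB 0 le_rfl) h1
      simp only [P, hA0]
      linarith
    · have hA' := hA z h
      have hB' := hB z hz
      have h1 := Real.sin_sq_add_cos_sq (t z)
      by_cases hc : Real.cos (t z) = 0
      · have h2 : Real.sin (t z) ^ 2 = 1 := by rw [hc] at h1; linarith
        simp only [P, h2, hc]
        linarith
      · have h2 : 0 < A z * Real.cos (t z) ^ 2 := by positivity
        have h3 : 0 ≤ B z * Real.sin (t z) ^ 2 := by positivity
        simp only [P]
        linarith
  have hG : ∀ c : ℝ, 0 < c → ContinuousOn (fun z : ℝ => Real.Gamma (c + z)) (Ici 0) := by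
    intro c hc z hz
    have hz' : (0 : ℝ) ≤ z := hz
    have hpos : 0 < c + z := by linarith
    have h1 : ContinuousAt Real.Gamma (c + z) :=
      (Real.differentiableAt_Gamma fun k => by
        have : (0 : ℝ) ≤ k := Nat.cast_nonneg k
        linarith).continuousAt
    exact (ContinuousAt.comp (f := fun z : ℝ => c + z) h1 (by fun_prop)).continuousWithinAt
  have htc : Continuous t := by fun_prop
  have hAc : ContinuousOn A (Ici 0) :=
    ((Real.continuous_sqrt.continuousOn).mul (hG _ (by norm_num))).div_const _
  have hBc : ContinuousOn B (Ici 0) := (hG _ (by norm_num)).div_const _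
  have hsc : ContinuousOn (fun z => Real.sin (t z)) (Ici 0) :=
    (Real.continuous_sin.comp htc).continuousOn
  have hcc : ContinuousOn (fun z => Real.cos (t z)) (Ici 0) :=
    (Real.continuous_cos.comp htc).continuousOn
  have hPc : ContinuousOn P (Ici 0) := (hAc.mul (hcc.pow 2)).add (hBc.mul (hsc.pow 2))
  have hQc : ContinuousOn Q (Ici 0) := (hBc.sub hAc).mul (hsc.mul hcc)
  refine ⟨fun z => t z + Real.arctan (Q z / P z), ?_, ?_, ?_⟩
  · exact htc.continuousOn.add
      (Real.continuous_arctan.comp_continuousOn (hQc.div hPc fun z hz => (hP z hz).ne'))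
  · have h1 : Q 0 / P 0 = -1 := by
      have h2 := hP 0 le_rfl
      rw [div_eq_iff h2.ne']
      simp only [P, Q, hA0, ht0, Real.sin_neg, Real.cos_neg, Real.sin_pi_div_four,
        Real.cos_pi_div_four]
      ring
    simp only [h1, ht0, Real.arctan_neg, Real.arctan_one]
    ring
  · intro z hz
    have hp := hP z hz
    have hcpos := Real.cos_arctan_pos (Q z / P z)
    have htan : Real.sin (Real.arctan (Q z / P z)) =
        Q z / P z * Real.cos (Real.arctan (Q z / P z)) := by
      have h := Real.tan_arctan (Q z / P z)
      rw [Real.tan_eq_sin_div_cos, div_eq_iff hcpos.ne'] at h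
      exact h
    have h1 := Real.sin_sq_add_cos_sq (t z)
    refine ⟨P z / Real.cos (Real.arctan (Q z / P z)), div_pos hp hcpos, ?_, ?_⟩
    · rw [hx z hz, Real.cos_add, htan]
      have : P z * Real.cos (t z) - Q z * Real.sin (t z) = A z * Real.cos (t z) := by
        have h2 : Real.sin (t z) ^ 2 = 1 - Real.cos (t z) ^ 2 := by linarith
        simp only [P, Q]
        linear_combination (A z * Real.cos (t z)) * h1
      rw [← this]
      field_simp
    · rw [hy z hz, Real.sin_add, htan]
      have : P z * Real.sin (t z) + Q z * Real.cos (t z) = B z * Real.sin (t z) := by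
        simp only [P, Q]
        linear_combination (B z * Real.sin (t z)) * h1
      rw [← this]
      field_simp

/-- The angle function `θ̃` on `[0, ∞)` (its values at negative numbers are irrelevant). -/
noncomputable def angleTheta : ℝ → ℝ := Classical.choose exists_isAngleFunction

theorem angleTheta_spec : IsAngleFunction angleTheta := Classical.choose_spec exists_isAngleFunction

/-- The defining properties determine the angle function on `[0, ∞)`. -/
theorem IsAngleFunction.eqOn {θ₁ θ₂ : ℝ → ℝ} (h₁ : IsAngleFunction θ₁) (h₂ : IsAngleFunction θ₂) :
    EqOn θ₁ θ₂ (Ici 0) := by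
  have hcos : ∀ z : ℝ, 0 ≤ z → Real.cos (θ₁ z - θ₂ z) = 1 := by
    intro z hz
    obtain ⟨r, hr, hr1, hr2⟩ := h₁.2.2 z hz
    obtain ⟨s, hs, hs1, hs2⟩ := h₂.2.2 z hz
    rw [← hs1] at hr1
    rw [← hs2] at hr2
    have e1 := Real.sin_sq_add_cos_sq (θ₁ z)
    have e2 := Real.sin_sq_add_cos_sq (θ₂ z)
    have hsq : r ^ 2 = s ^ 2 := by
      have : (r * Real.sin (θ₁ z)) ^ 2 + (r * Real.cos (θ₁ z)) ^ 2 =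
        (s * Real.sin (θ₂ z)) ^ 2 + (s * Real.cos (θ₂ z)) ^ 2 := by rw [hr1, hr2]
      nlinarith
    have hrs : r = s := by
      rw [sq_eq_sq₀ hr.le hs.le] at hsq
      exact hsq
    subst hrs
    have c1 := mul_left_cancel₀ hr.ne' hr1
    have c2 := mul_left_cancel₀ hr.ne' hr2
    rw [Real.cos_sub, c1, c2]
    linarith
  have hc : ContinuousOn (fun z => θ₁ z - θ₂ z) (Ici 0) := h₁.1.sub h₂.1
  intro z hz
  by_contra hne
  have hz' : (0 : ℝ) ≤ z := hz
  have hpre : (fun z => θ₁ z - θ₂ z) '' Ici 0 ⊆ range fun k : ℤ => (k : ℝ) * (2 * Real.pi) := by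
    rintro _ ⟨w, hw, rfl⟩
    obtain ⟨k, hk⟩ := (Real.cos_eq_one_iff _).1 (hcos w hw)
    exact ⟨k, hk⟩
  have hsub : ((fun z => θ₁ z - θ₂ z) '' Ici 0).Subsingleton :=
    (((countable_range _).mono hpre).isTotallyDisconnected) _ subset_rfl
      (isPreconnected_Ici.image _ hc)
  have := hsub ⟨z, hz, rfl⟩ ⟨0, self_mem_Ici, rfl⟩
  simp only [h₁.2.1, h₂.2.1] at this
  exact hne (by linarith)

/-- The quantity `√(2m) ℓ √E / h + θ̃(E / (2 h ωm)) + θ̃(E / (2 h ωp))`. -/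
noncomputable def quantizationPhase (h m ℓ ωm ωp E : ℝ) : ℝ :=
  Real.sqrt (2 * m) * ℓ * Real.sqrt E / h + angleTheta (E / (2 * h * ωm))
    + angleTheta (E / (2 * h * ωp))

/-- `e 0 < e 1 < e 2 < ⋯` is the list of all eigenvalues of `A`, in increasing order. -/
def EnumeratesEigenvalues {H : Type*} [AddCommGroup H] [Module ℂ H] (A : H →ₗ.[ℂ] H)
    (e : ℕ → ℝ) : Prop :=
  StrictMono e ∧ ∀ E : ℂ, IsUnboundedEigenvalue A E ↔ ∃ n : ℕ, E = (e n : ℂ)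

/-! Put `k = √(2mE)/ħ`. On each outer half-line the equation `-(ħ²/2m)u'' + Vu = Eu` is a rescaled
Weber equation, with parameter `E/(2ħω)`. Up to a factor it has one solution that is square
integrable at infinity, and the reciprocal Gamma values in the definition of `θ̃` are, up to scale,
its data at the junction: `u : u' = cos θ̃ : k sin θ̃` in the outward direction
(`IsAngleFunction.exists_decaying`, `IsAngleFunction.data_of_isL2Solution`). On the flat part
solutions are `cos(kx + c)`, so a square integrable solution matches at both ends exactly when
`sin(kℓ + θ̃ + θ̃) = 0` (`IsBathtubCoeff.sin_eq_zero`, `IsBathtubCoeff.exists_solution`). Simplicity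
holds because the data at `ℓ` are fixed up to a scalar. Energy identities for `Re(ū u')` and `Im(ū
u')` exclude every `E` that is not real and positive.

For the numbering, the phase is continuous and equals `-π` at `E = 0`. It tends to `+∞` and is
strictly increasing, so each `πn` with `n ≥ 0` is attained exactly once on `E > 0` and no other
multiple of `π` is. The delicate point is that `θ̃` increases (`IsAngleFunction.strictMonoOn`). The
reflection formula makes the curve an ellipse-like motion with phase `π(z - 1/4)` and varying
semi-axes, and log-convexity of `Γ` shows that the axes vary too slowly to reverse the rotation. -/

/-! ### Growth and strict monotonicity of the angle function. -/

/-- The quotient `Γ(z + 3/4) / Γ(z + 1/4)` is nondecreasing for `z ≥ 0`, by log-convexity of `Γ`. -/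
theorem Gamma_quotient_mono {y z : ℝ} (hy : 0 ≤ y) (hyz : y ≤ z) :
    Real.Gamma (1 / 4 + z) * Real.Gamma (3 / 4 + y) ≤
      Real.Gamma (1 / 4 + y) * Real.Gamma (3 / 4 + z) := by
  have h1 : 0 < Real.Gamma (1 / 4 + y) := Real.Gamma_pos_of_pos (by linarith)
  have h2 : 0 < Real.Gamma (1 / 4 + z) := Real.Gamma_pos_of_pos (by linarith)
  have h3 : 0 < Real.Gamma (3 / 4 + y) := Real.Gamma_pos_of_pos (by linarith)
  have h4 : 0 < Real.Gamma (3 / 4 + z) := Real.Gamma_pos_of_pos (by linarith)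
  rw [← Real.log_le_log_iff (by positivity) (by positivity), Real.log_mul h2.ne' h3.ne',
    Real.log_mul h1.ne' h4.ne']
  have hc := Real.convexOn_log_Gamma
  -- `d` is the distance from `1/4 + y` to `3/4 + z`. The points `1/4 + z` and `3/4 + y` lie between
  -- these two with complementary weights, so adding the two convexity inequalities gives the claim.
  obtain ⟨d, rfl⟩ : ∃ d, z = y + (d - 1 / 2) := ⟨z - y + 1 / 2, by ring⟩
  have hd : 0 < d := by linarith
  have hpy : (1 / 4 + y) ∈ Ioi (0 : ℝ) := by simp only [mem_Ioi]; linarith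
  have hpz : (3 / 4 + (y + (d - 1 / 2))) ∈ Ioi (0 : ℝ) := by simp only [mem_Ioi]; linarith
  have ha : 0 ≤ (1 / 2) / d := by positivity
  have hb : 0 ≤ (d - 1 / 2) / d := div_nonneg (by linarith) hd.le
  have hab : (1 / 2) / d + (d - 1 / 2) / d = 1 := by field_simp; ring
  have e1 := hc.2 hpy hpz ha hb hab
  have e2 := hc.2 hpy hpz hb ha (by rw [add_comm]; exact hab)
  have i1 : (1 / 2) / d * (1 / 4 + y) + (d - 1 / 2) / d * (3 / 4 + (y + (d - 1 / 2)))
      = 1 / 4 + (y + (d - 1 / 2)) := by field_simp; ring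
  have i2 : (d - 1 / 2) / d * (1 / 4 + y) + (1 / 2) / d * (3 / 4 + (y + (d - 1 / 2)))
      = 3 / 4 + y := by field_simp; ring
  simp only [smul_eq_mul, Function.comp_apply, i1, i2] at e1 e2
  set f := Real.log (Real.Gamma (1 / 4 + y))
  set g := Real.log (Real.Gamma (3 / 4 + (y + (d - 1 / 2))))
  have : ((1 / 2) / d + (d - 1 / 2) / d) * (f + g) = f + g := by
    rw [hab, one_mul]
  linarith

/-- Shifting the monotone quotient by `1/2` and using `Γ(s + 1) = sΓ(s)` bounds the growth of the
same quotient from above. -/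
theorem Gamma_quotient_le {y z : ℝ} (hy : 0 ≤ y) (hyz : y ≤ z) :
    Real.Gamma (1 / 4 + y) * Real.Gamma (3 / 4 + z) * (1 / 4 + y) ≤
      Real.Gamma (1 / 4 + z) * Real.Gamma (3 / 4 + y) * (1 / 4 + z) := by
  have h := Gamma_quotient_mono (y := y + 1 / 2) (z := z + 1 / 2) (by linarith) (by linarith)
  have hs (w : ℝ) (hw : 0 ≤ w) : Real.Gamma (3 / 4 + (w + 1 / 2)) =
      (1 / 4 + w) * Real.Gamma (1 / 4 + w) := by
    rw [← Real.Gamma_add_one (by linarith)]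
    ring_nf
  rw [hs y hy, hs z (by linarith), show 1 / 4 + (y + 1 / 2) = 3 / 4 + y by ring,
    show 1 / 4 + (z + 1 / 2) = 3 / 4 + z by ring] at h
  linarith

/-- The curve defining the angle function, after the reflection formula for `Γ`. -/
theorem IsAngleFunction.exists_polar {θ : ℝ → ℝ} (hθ : IsAngleFunction θ) {z : ℝ} (hz : 0 ≤ z) :
    ∃ r : ℝ, 0 < r ∧
      r * Real.cos (θ z) =
        Real.sqrt z * Real.Gamma (1 / 4 + z) * Real.cos (Real.pi * (z - 1 / 4)) ∧
      r * Real.sin (θ z) = Real.Gamma (3 / 4 + z) * Real.sin (Real.pi * (z - 1 / 4)) := by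
  obtain ⟨r, hr, h1, h2⟩ := hθ.2.2 z hz
  have e1 := one_div_Gamma_reflect (1 / 4 + z) (by linarith)
  rw [show (1 : ℝ) - (1 / 4 + z) = 3 / 4 - z by ring,
    show Real.pi * (1 / 4 + z) = Real.pi * (z - 1 / 4) + Real.pi / 2 by ring,
    Real.sin_add_pi_div_two] at e1
  have e2 := one_div_Gamma_reflect (3 / 4 + z) (by linarith)
  rw [show (1 : ℝ) - (3 / 4 + z) = 1 / 4 - z by ring,
    show Real.pi * (3 / 4 + z) = Real.pi * (z - 1 / 4) + Real.pi by ring,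
    Real.sin_add_pi] at e2
  refine ⟨r * Real.pi, mul_pos hr Real.pi_pos, ?_, ?_⟩
  · rw [mul_right_comm, h1, div_eq_mul_one_div, e1]
    field_simp
  · rw [mul_right_comm, h2, e2]
    field_simp

/-- A real function on an interval whose cosine stays positive and which starts in `(-π/2, π/2)`
stays in `(-π/2, π/2)`. -/
theorem abs_lt_pi_div_two_of_cos_pos {s : Set ℝ} (hs : IsPreconnected s) {φ : ℝ → ℝ}
    (hφ : ContinuousOn φ s) (hcos : ∀ x ∈ s, 0 < Real.cos (φ x)) {a : ℝ} (ha : a ∈ s)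
    (h0 : |φ a| < Real.pi / 2) {x : ℝ} (hx : x ∈ s) : |φ x| < Real.pi / 2 := by
  by_contra hcon
  push Not at hcon
  obtain ⟨y, hy, hy'⟩ := hs.intermediate_value ha hx hφ.abs ⟨h0.le, hcon⟩
  have h := hcos y hy
  rw [← Real.cos_abs] at h
  simp only at hy'
  rw [hy', Real.cos_pi_div_two] at h
  exact lt_irrefl _ h

/-- With `t = π(z - 1/4)`, the polar form makes `r cos(θ - t)` a combination of `cos² t` and `sin²
t` with nonnegative weights. It vanishes nowhere: only the cosine weight can be zero, at `z = 0`,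
and there `sin t ≠ 0`. -/
theorem IsAngleFunction.abs_sub_lt {θ : ℝ → ℝ} (hθ : IsAngleFunction θ) {z : ℝ} (hz : 0 ≤ z) :
    |θ z - Real.pi * (z - 1 / 4)| < Real.pi / 2 := by
  refine abs_lt_pi_div_two_of_cos_pos (φ := fun z => θ z - Real.pi * (z - 1 / 4))
    (isPreconnected_Ici (a := (0 : ℝ))) (hθ.1.sub (by fun_prop)) ?_ self_mem_Ici ?_ hz
  · intro w hw
    have hw' : (0 : ℝ) ≤ w := hw
    obtain ⟨r, hr, h1, h2⟩ := hθ.exists_polar hw'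
    set t := Real.pi * (w - 1 / 4) with ht
    have hA : 0 < Real.Gamma (1 / 4 + w) := Real.Gamma_pos_of_pos (by linarith)
    have hB : 0 < Real.Gamma (3 / 4 + w) := Real.Gamma_pos_of_pos (by linarith)
    have key : r * Real.cos (θ w - t) = Real.sqrt w * Real.Gamma (1 / 4 + w) * Real.cos t ^ 2 +
        Real.Gamma (3 / 4 + w) * Real.sin t ^ 2 := by
      rw [Real.cos_sub]
      linear_combination Real.cos t * h1 + Real.sin t * h2
    refine pos_of_mul_pos_right (a := r) ?_ hr.le
    rw [key]
    by_cases hsin : Real.sin t = 0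
    · have hc : Real.cos t ^ 2 = 1 := by
        have := Real.sin_sq_add_cos_sq t
        rw [hsin] at this
        linarith
      have hw0 : 0 < w := by
        rcases hw'.eq_or_lt with h | h
        · exfalso
          rw [ht, ← h, show Real.pi * (0 - 1 / 4) = -(Real.pi / 4) by ring, Real.sin_neg,
            Real.sin_pi_div_four] at hsin
          have : (0 : ℝ) < Real.sqrt 2 := by positivity
          linarith
        · exact h
      rw [hsin, hc]
      have := Real.sqrt_pos.2 hw0
      positivity
    · positivity
  · simp only [hθ.2.1]
    rw [show -(Real.pi / 2) - Real.pi * (0 - 1 / 4) = -(Real.pi / 4) by ring, abs_neg,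
      abs_of_pos (by positivity)]
    linarith [Real.pi_pos]

theorem IsAngleFunction.tendsto_atTop {θ : ℝ → ℝ} (hθ : IsAngleFunction θ) :
    Filter.Tendsto θ Filter.atTop Filter.atTop := by
  have h1 : Filter.Tendsto (fun z : ℝ => Real.pi * z - Real.pi) Filter.atTop Filter.atTop :=
    Filter.tendsto_atTop_add_const_right _ _ (Filter.tendsto_id.const_mul_atTop Real.pi_pos)
  refine Filter.tendsto_atTop_mono' _ ?_ h1
  filter_upwards [Filter.eventually_ge_atTop (0 : ℝ)] with z hz
  have := (abs_lt.1 (hθ.abs_sub_lt hz)).1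
  linarith [Real.pi_pos]

/-- As `q ≤ p`, the ratio `(bq - ap)/(ap + bq)` is at most `(b - a)/(b + a) = (b² - a²)/(a + b)²`,
and `2(a + b)² > 1`. -/
theorem mul_add_mul_sub_lt {a b p q : ℝ} (ha : 0 < a) (hab : a < b) (hp : 0 < p) (hq : 0 < q) (hqp : q ≤ p)
    (h : 1 / 2 < a ^ 2 + b ^ 2) :
    b * q - a * p < (a * p + b * q) * (2 * (b ^ 2 - a ^ 2)) := by
  rcases le_or_gt (b * q - a * p) 0 with h0 | h0
  · have hb : 0 < b := ha.trans hab
    have : 0 < b ^ 2 - a ^ 2 := by nlinarith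
    exact h0.trans_lt (by positivity)
  have e1 : (b * q - a * p) * (a + b) ≤ (a * p + b * q) * (b - a) := by
    have := mul_le_mul_of_nonneg_left hqp (mul_pos ha (ha.trans hab)).le
    linarith
  have e2 := mul_le_mul_of_nonneg_right e1 (a := a + b) (by linarith)
  have e3 : 0 < (b * q - a * p) * (a ^ 2 + b ^ 2 - 1 / 2) := mul_pos h0 (by linarith)
  have e4 : 0 < (b * q - a * p) * (a * b) := mul_pos h0 (mul_pos ha (ha.trans hab))
  linarith

/-- Only the extreme values `S = ±1` matter. A bound on `Q - P` is needed only where `S > 0`, which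
is the only place where one will be available. -/
theorem sub_mul_add_add_mul_pos {P Q S D d : ℝ} (h0 : 0 < P + Q) (hd : 0 < d) (hS : -1 ≤ S)
    (hS' : S ≤ 1) (hD : d ≤ D) (hup : P - Q < (P + Q) * d) (hlow : 0 < S → Q - P < (P + Q) * d) :
    0 < (P - Q) * S + (P + Q) * D := by
  have h1 : (P + Q) * d ≤ (P + Q) * D := mul_le_mul_of_nonneg_left hD h0.le
  have h2 : 0 < (P + Q) * d := mul_pos h0 hd
  rcases le_or_gt P Q with hPQ | hPQ
  · rcases le_or_gt S 0 with hs | hs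
    · have := mul_nonneg_of_nonpos_of_nonpos (sub_nonpos.2 hPQ) hs
      linarith
    · have := mul_le_mul_of_nonneg_left hS' (sub_nonneg.2 hPQ)
      linarith [hlow hs]
  · have := mul_le_mul_of_nonneg_left hS (sub_nonneg.2 hPQ.le)
    linarith

/-- The sine is, up to a positive factor, the cross product of two points of the curve. It splits
into a rotation term with `sin(u - t)`, bounded below by Jordan's inequality (whence the range `z ≤
y + 1/2`), and a distortion term with `sin(t + u)`, controlled by the two Gamma quotient
inequalities. -/
theorem IsAngleFunction.sin_sub_pos {θ : ℝ → ℝ} (hθ : IsAngleFunction θ) {y z : ℝ} (hy : 0 < y)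
    (hyz : y < z) (hzy : z ≤ y + 1 / 2) : 0 < Real.sin (θ z - θ y) := by
  obtain ⟨r, hr, h1, h2⟩ := hθ.exists_polar hy.le
  obtain ⟨s, hs, h3, h4⟩ := hθ.exists_polar (hy.trans hyz).le
  have hz : 0 < z := hy.trans hyz
  have g1 : 0 < Real.Gamma (1 / 4 + y) := Real.Gamma_pos_of_pos (by linarith)
  have g2 : 0 < Real.Gamma (1 / 4 + z) := Real.Gamma_pos_of_pos (by linarith)
  have g3 : 0 < Real.Gamma (3 / 4 + y) := Real.Gamma_pos_of_pos (by linarith)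
  have g4 : 0 < Real.Gamma (3 / 4 + z) := Real.Gamma_pos_of_pos (by linarith)
  have hm := Gamma_quotient_mono hy.le hyz.le
  have hl := Gamma_quotient_le hy.le hyz.le
  have sy := Real.sqrt_pos.2 hy
  have syz : Real.sqrt y < Real.sqrt z := Real.sqrt_lt_sqrt hy.le hyz
  have qy := Real.sq_sqrt hy.le
  have qz := Real.sq_sqrt hz.le
  obtain ⟨t, ht⟩ : ∃ t, t = Real.pi * (y - 1 / 4) := ⟨_, rfl⟩
  obtain ⟨u, hu⟩ : ∃ u, u = Real.pi * (z - 1 / 4) := ⟨_, rfl⟩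
  rw [← ht] at h1 h2
  rw [← hu] at h3 h4
  generalize Real.sqrt y = a at *
  generalize Real.sqrt z = b at *
  generalize Real.Gamma (1 / 4 + y) = k₁ at *
  generalize Real.Gamma (1 / 4 + z) = k₂ at *
  generalize Real.Gamma (3 / 4 + y) = k₃ at *
  generalize Real.Gamma (3 / 4 + z) = k₄ at *
  have key : r * s * Real.sin (θ z - θ y) =
      ((a * (k₁ * k₄) - b * (k₂ * k₃)) * Real.sin (t + u) +
        (a * (k₁ * k₄) + b * (k₂ * k₃)) * Real.sin (u - t)) / 2 := by
    rw [Real.sin_sub, Real.sin_add, Real.sin_sub]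
    linear_combination (s * Real.sin (θ z)) * h1 + (a * k₁ * Real.cos t) * h4
      - (s * Real.cos (θ z)) * h2 - k₃ * Real.sin t * h3
  have hp0 : 0 < k₁ * k₄ := mul_pos g1 g4
  have hq0 : 0 < k₂ * k₃ := mul_pos g2 g3
  generalize k₁ * k₄ = p at *
  generalize k₂ * k₃ = q at *
  have sz : 0 < b := sy.trans syz
  have hsin : 2 * (z - y) ≤ Real.sin (u - t) := by
    have := Real.mul_le_sin (x := u - t) (by rw [hu, ht]; nlinarith [Real.pi_pos])
      (by rw [hu, ht]; nlinarith [Real.pi_pos])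
    refine le_trans (le_of_eq ?_) this
    rw [hu, ht]
    have := Real.pi_pos
    field_simp
    ring
  have hab : 0 < a * p + b * q := by positivity
  refine pos_of_mul_pos_right (a := r * s) ?_ (by positivity)
  rw [key]
  have habs : -1 ≤ Real.sin (t + u) ∧ Real.sin (t + u) ≤ 1 :=
    ⟨Real.neg_one_le_sin _, Real.sin_le_one _⟩
  have hup : a * p - b * q < (a * p + b * q) * (2 * (z - y)) := by
    have e1 : (a * p) * (1 / 4 + y) ≤ (b * q) * (1 / 4 + z) := by
      calc (a * p) * (1 / 4 + y) = a * (p * (1 / 4 + y)) := by ring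
        _ ≤ b * (q * (1 / 4 + z)) := by gcongr
        _ = _ := by ring
    have e2 : 0 < a * p := by positivity
    have e3 : 0 < b * q := by positivity
    rcases le_or_gt (a * p) (b * q) with hc | hc
    · exact lt_of_le_of_lt (by linarith) (mul_pos hab (by linarith))
    · have f1 : 0 < (a * p - b * q) * y := mul_pos (by linarith) hy
      have f2 : 0 < (a * p - b * q) * (z - y) := mul_pos (by linarith) (by linarith)
      linarith
  refine half_pos (sub_mul_add_add_mul_pos hab (by linarith) habs.1 habs.2 hsin hup fun hn => ?_)
  -- Here `t + u = π(y + z - 1/2)`, so a positive sine forces `y + z > 1/2`.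
  have hyz2 : 1 / 2 < y + z := by
    by_contra hcon
    push Not at hcon
    have : Real.sin (t + u) ≤ 0 := Real.sin_nonpos_of_nonpos_of_neg_pi_le
      (by rw [hu, ht]; nlinarith [Real.pi_pos]) (by rw [hu, ht]; nlinarith [Real.pi_pos])
    linarith
  have hlow := mul_add_mul_sub_lt sy syz hp0 hq0 hm (by rw [qy, qz]; exact hyz2)
  rwa [qy, qz] at hlow

theorem IsAngleFunction.lt_of_lt_of_le {θ : ℝ → ℝ} (hθ : IsAngleFunction θ) {y z : ℝ} (hy : 0 < y)
    (hyz : y < z) (hzy : z ≤ y + 1 / 2) : θ y < θ z := by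
  by_contra hcon
  push Not at hcon
  have hc : ContinuousOn (fun w => θ w - θ y) (Icc y z) :=
    (hθ.1.mono fun w hw => (hy.le.trans hw.1 : (0 : ℝ) ≤ w)).sub continuousOn_const
  have h0 := hθ.sin_sub_pos hy hyz hzy
  -- A nonpositive difference with positive sine lies below `-π`; on the way there it would pass
  -- through `-π/2`, where the sine is negative.
  have h1 : θ z - θ y < -Real.pi := by
    by_contra hcon2
    push Not at hcon2
    have := Real.sin_nonpos_of_nonpos_of_neg_pi_le (x := θ z - θ y) (by linarith) hcon2
    linarith
  obtain ⟨w, hw, hw'⟩ := intermediate_value_Icc' hyz.le hc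
    (show -(Real.pi / 2) ∈ Icc (θ z - θ y) (θ y - θ y) from
      ⟨by linarith [Real.pi_pos], by linarith [Real.pi_pos]⟩)
  simp only at hw'
  have hyw : y < w := by
    rcases hw.1.eq_or_lt with h | h
    · rw [← h, sub_self] at hw'
      linarith [Real.pi_pos]
    · exact h
  have := hθ.sin_sub_pos hy hyw (hw.2.trans hzy)
  rw [hw', Real.sin_neg, Real.sin_pi_div_two] at this
  linarith

theorem IsAngleFunction.strictMonoOn {θ : ℝ → ℝ} (hθ : IsAngleFunction θ) :
    StrictMonoOn θ (Ici 0) := by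
  have hstep : ∀ n : ℕ, ∀ y z : ℝ, 0 < y → y < z → z ≤ y + (n + 1) * (1 / 2) → θ y < θ z := by
    intro n
    induction n with
    | zero =>
      intro y z hy hyz h
      exact hθ.lt_of_lt_of_le hy hyz (by simpa using h)
    | succ n ih =>
      intro y z hy hyz h
      rcases le_or_gt z (y + 1 / 2) with h' | h'
      · exact hθ.lt_of_lt_of_le hy hyz h'
      · exact (hθ.lt_of_lt_of_le hy (by linarith) le_rfl).trans
          (ih (y + 1 / 2) z (by linarith) h' (by push_cast at h; linarith))
  have hpos : ∀ y z : ℝ, 0 < y → y < z → θ y < θ z := by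
    intro y z hy hyz
    obtain ⟨n, hn⟩ := exists_nat_ge ((z - y) * 2)
    exact hstep n y z hy hyz (by linarith)
  intro y hy z hz hyz
  have hy' : (0 : ℝ) ≤ y := hy
  rcases hy'.eq_or_lt with h | h
  · subst h
    refine lt_of_le_of_lt ?_ (hpos (z / 2) z (by linarith) (by linarith))
    -- The comparison at the endpoint `0` follows by continuity, with `z / 2` inserted to keep the
    -- inequality strict.
    have hcw : Filter.Tendsto θ (nhdsWithin 0 (Ioi 0)) (nhds (θ 0)) :=
      (hθ.1 0 self_mem_Ici).mono_left (nhdsWithin_mono _ Ioi_subset_Ici_self)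
    refine le_of_tendsto hcw ?_
    filter_upwards [Ioo_mem_nhdsGT (show (0 : ℝ) < z / 2 by linarith)] with w hw
    exact (hpos w (z / 2) hw.1 hw.2).le
  · exact hpos y z h hyz

/-! ### Decaying solutions of the Weber equation and their data at the origin. -/

/-- The integral `∫₀^∞ t ^ a exp (-t² - 2 s t) dt`, which up to a Gaussian factor is a parabolic
cylinder function of `s`. -/
noncomputable def gaussianMoment (a s : ℝ) : ℝ :=
  ∫ t in Ioi (0 : ℝ), t ^ a * Real.exp (-t ^ 2 - 2 * s * t)

/-- From `(t + 2s)² ≥ 0` one gets `-t² - 2st ≤ 2s² - t²/2`. -/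
theorem integrableOn_gaussianMoment {a : ℝ} (ha : -1 < a) (s : ℝ) :
    IntegrableOn (fun t : ℝ => t ^ a * Real.exp (-t ^ 2 - 2 * s * t)) (Ioi 0) := by
  have h := (integrableOn_rpow_mul_exp_neg_mul_sq (b := 1 / 2) (by norm_num) ha).const_mul
    (Real.exp (2 * s ^ 2))
  refine Integrable.mono' h (by fun_prop) ?_
  filter_upwards [ae_restrict_mem measurableSet_Ioi] with t ht
  have ht' : (0 : ℝ) < t := ht
  have h0 : 0 ≤ t ^ a := Real.rpow_nonneg ht'.le a
  rw [Real.norm_of_nonneg (by positivity), mul_left_comm, ← Real.exp_add]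
  refine mul_le_mul_of_nonneg_left (Real.exp_le_exp.2 ?_) h0
  nlinarith [sq_nonneg (t + 2 * s)]

theorem hasDerivAt_gaussianMoment {a : ℝ} (ha : -1 < a) (s : ℝ) :
    HasDerivAt (gaussianMoment a) (-2 * gaussianMoment (a + 1) s) s := by
  -- The parameter `-(|s| + 1)` lies below every point of the unit ball around `s`, so it dominates
  -- there.
  have hb := (integrableOn_gaussianMoment (a := a + 1) (by linarith) (-(|s| + 1))).const_mul 2
  have h := (hasDerivAt_integral_of_dominated_loc_of_deriv_le (μ := volume.restrict (Ioi (0 : ℝ)))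
    (F := fun s t : ℝ => t ^ a * Real.exp (-t ^ 2 - 2 * s * t))
    (F' := fun s t : ℝ => -2 * (t ^ (a + 1) * Real.exp (-t ^ 2 - 2 * s * t)))
    (x₀ := s) (Metric.ball_mem_nhds s one_pos)
    (Filter.Eventually.of_forall fun w => (integrableOn_gaussianMoment ha w).aestronglyMeasurable)
    (integrableOn_gaussianMoment ha s) (by fun_prop) ?_ hb ?_).2
  · rw [integral_const_mul] at h
    exact h
  · filter_upwards [ae_restrict_mem measurableSet_Ioi] with t ht w hw
    have ht' : (0 : ℝ) < t := ht
    have h0 : 0 ≤ t ^ (a + 1) := Real.rpow_nonneg ht'.le _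
    rw [norm_mul, norm_neg, Real.norm_ofNat, Real.norm_of_nonneg (by positivity)]
    gcongr
    rw [Metric.mem_ball, Real.dist_eq, abs_lt] at hw
    have := neg_abs_le s
    nlinarith
  · filter_upwards [ae_restrict_mem measurableSet_Ioi] with t ht w _
    have ht' : (0 : ℝ) < t := ht
    have h1 : HasDerivAt (fun w : ℝ => -t ^ 2 - 2 * w * t) (-(2 * t)) w := by
      simpa using ((((hasDerivAt_id w).const_mul 2).mul_const t).const_sub (-t ^ 2))
    refine (h1.exp.const_mul (t ^ a)).congr_deriv ?_
    rw [Real.rpow_add ht', Real.rpow_one]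
    ring

/-- Integrate the derivative of `t ^ (a + 1) exp(-t² - 2st)`. It vanishes at `0` because `a + 1 >
0`, and at infinity. -/
theorem gaussianMoment_recurrence {a : ℝ} (ha : -1 < a) (s : ℝ) :
    (a + 1) * gaussianMoment a s =
      2 * gaussianMoment (a + 2) s + 2 * s * gaussianMoment (a + 1) s := by
  have i0 := integrableOn_gaussianMoment ha s
  have i1 := integrableOn_gaussianMoment (a := a + 1) (by linarith) s
  have i2 := integrableOn_gaussianMoment (a := a + 2) (by linarith) s
  have hd : ∀ t ∈ Ioi (0 : ℝ), HasDerivAt (fun t : ℝ => t ^ (a + 1) * Real.exp (-t ^ 2 - 2 * s * t))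
      ((a + 1) * (t ^ a * Real.exp (-t ^ 2 - 2 * s * t)) -
        (2 * (t ^ (a + 2) * Real.exp (-t ^ 2 - 2 * s * t)) +
        2 * s * (t ^ (a + 1) * Real.exp (-t ^ 2 - 2 * s * t)))) t := by
    intro t ht
    have ht' : (0 : ℝ) < t := ht
    have h1 : HasDerivAt (fun t : ℝ => -t ^ 2 - 2 * s * t) (-(2 * t) - 2 * s) t := by
      refine ((hasDerivAt_pow 2 t).fun_neg.fun_sub ((hasDerivAt_id' t).const_mul (2 * s))).congr_deriv ?_
      norm_num
    refine ((Real.hasDerivAt_rpow_const (p := a + 1) (Or.inl ht'.ne')).fun_mul h1.exp).congr_deriv ?_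
    rw [show a + 2 = a + 1 + 1 by ring, Real.rpow_add ht' (a + 1), Real.rpow_one,
      show a + 1 - 1 = a by ring]
    ring
  have hint := ((i0.const_mul (a + 1)).sub ((i2.const_mul 2).add (i1.const_mul (2 * s))))
  have hlim := tendsto_zero_of_hasDerivAt_of_integrableOn_Ioi hd hint i1
  have hz : (0 : ℝ) ^ (a + 1) = 0 := Real.zero_rpow (by linarith)
  have h := integral_Ioi_of_hasDerivAt_of_tendsto (a := 0) ?_ hd hint hlim
  · have e1 := integral_sub (i0.const_mul (a + 1)) ((i2.const_mul 2).add (i1.const_mul (2 * s)))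
    have e2 := integral_add (i2.const_mul 2) (i1.const_mul (2 * s))
    simp only [Pi.add_apply] at e1
    rw [h, e2, integral_const_mul, integral_const_mul, integral_const_mul, hz, zero_mul,
      sub_zero] at e1
    unfold gaussianMoment
    linarith
  · have h1 : Continuous fun t : ℝ => t ^ (a + 1) := Real.continuous_rpow_const (by linarith)
    have h2 : Continuous fun t : ℝ => Real.exp (-t ^ 2 - 2 * s * t) := by fun_prop
    exact (h1.mul h2).continuousWithinAt

theorem gaussianMoment_zero {a : ℝ} (ha : -1 < a) :
    gaussianMoment a 0 = 1 / 2 * Real.Gamma ((a + 1) / 2) := by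
  rw [← integral_rpow_mul_exp_neg_rpow two_pos ha]
  unfold gaussianMoment
  simp

theorem gaussianMoment_nonneg (a s : ℝ) : 0 ≤ gaussianMoment a s := by
  refine setIntegral_nonneg measurableSet_Ioi fun t ht => ?_
  have ht' : (0 : ℝ) < t := ht
  have := Real.rpow_nonneg ht'.le a
  positivity

theorem gaussianMoment_le {a : ℝ} (ha : -1 < a) {s : ℝ} (hs : 0 ≤ s) :
    gaussianMoment a s ≤ gaussianMoment a 0 := by
  refine setIntegral_mono_on (integrableOn_gaussianMoment ha s) (integrableOn_gaussianMoment ha 0)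
    measurableSet_Ioi fun t ht => ?_
  have ht' : (0 : ℝ) < t := ht
  have := Real.rpow_nonneg ht'.le a
  gcongr

/-- `f` is a solution of the Weber equation `f'' = (s² - 4 z) f` with derivative `f'`, rapidly
decreasing at `+∞`. -/
structure IsParabolicCylinder (z : ℝ) (f f' : ℝ → ℝ) : Prop where
  deriv_fst (s : ℝ) : HasDerivAt f (f' s) s
  deriv_snd (s : ℝ) : HasDerivAt f' ((s ^ 2 - 4 * z) * f s) s
  decay (k : ℕ) : ∃ C : ℝ, ∀ s : ℝ, 0 ≤ s → s ^ k * |f s| ≤ C ∧ s ^ k * |f' s| ≤ C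

theorem pow_mul_exp_neg_sq_le (k : ℕ) {s : ℝ} (hs : 0 ≤ s) :
    s ^ k * Real.exp (-s ^ 2 / 2) ≤ k.factorial * Real.exp (1 / 2) := by
  have h1 : s ^ k ≤ k.factorial * Real.exp s := by
    have := Real.pow_div_factorial_le_exp s hs k
    rw [div_le_iff₀ (by positivity)] at this
    linarith
  calc s ^ k * Real.exp (-s ^ 2 / 2) ≤ (k.factorial * Real.exp s) * Real.exp (-s ^ 2 / 2) := by
        gcongr
    _ = k.factorial * Real.exp (s + -s ^ 2 / 2) := by rw [Real.exp_add]; ring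
    _ ≤ _ := by
        gcongr
        nlinarith [sq_nonneg (s - 1)]

/-- The bound on `z` is exactly what makes the moment exponent `-2z - 1/2` exceed `-1`; the
recurrence becomes the Weber equation. -/
theorem isParabolicCylinder_gaussianMoment {z : ℝ} (hz : z < 1 / 4) :
    IsParabolicCylinder z (fun s => Real.exp (-s ^ 2 / 2) * gaussianMoment (-2 * z - 1 / 2) s)
      (fun s => Real.exp (-s ^ 2 / 2) * (-s * gaussianMoment (-2 * z - 1 / 2) s -
        2 * gaussianMoment (-2 * z - 1 / 2 + 1) s)) := by
  have ha : -1 < -2 * z - 1 / 2 := by linarith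
  generalize hab : -2 * z - 1 / 2 = a at *
  have hE (s : ℝ) : HasDerivAt (fun s : ℝ => Real.exp (-s ^ 2 / 2))
      (Real.exp (-s ^ 2 / 2) * (-s)) s := by
    have h1 : HasDerivAt (fun t : ℝ => -t ^ 2 / 2) (-s) s := by
      refine ((hasDerivAt_pow 2 s).fun_neg.div_const 2).congr_deriv ?_
      push_cast
      ring
    exact h1.exp
  have h0 := hasDerivAt_gaussianMoment ha
  have h1 := hasDerivAt_gaussianMoment (a := a + 1) (by linarith)
  refine ⟨fun s => ?_, fun s => ?_, fun k => ?_⟩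
  · refine ((hE s).fun_mul (h0 s)).congr_deriv ?_
    ring
  · refine ((hE s).fun_mul (((hasDerivAt_id' s).fun_neg.fun_mul (h0 s)).fun_sub
      ((h1 s).const_mul 2))).congr_deriv ?_
    have hr := gaussianMoment_recurrence ha s
    rw [show a + 1 + 1 = a + 2 by ring]
    have hz4 : 4 * z = -2 * a - 1 := by linarith
    rw [hz4]
    linear_combination -2 * Real.exp (-s ^ 2 / 2) * hr
  · refine ⟨max (k.factorial * Real.exp (1 / 2) * gaussianMoment a 0)
      ((k + 1).factorial * Real.exp (1 / 2) * gaussianMoment a 0 +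
        2 * (k.factorial * Real.exp (1 / 2) * gaussianMoment (a + 1) 0)), fun s hs => ⟨?_, ?_⟩⟩
    · refine le_max_of_le_left ?_
      have := gaussianMoment_nonneg a s
      rw [abs_of_nonneg (by positivity), ← mul_assoc]
      exact mul_le_mul (pow_mul_exp_neg_sq_le k hs) (gaussianMoment_le ha hs) this (by positivity)
    · refine le_max_of_le_right ?_
      have n1 := gaussianMoment_nonneg a s
      have n2 := gaussianMoment_nonneg (a + 1) s
      rw [abs_mul, abs_of_pos (Real.exp_pos _)]
      have h3 : |-s * gaussianMoment a s - 2 * gaussianMoment (a + 1) s| =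
          s * gaussianMoment a s + 2 * gaussianMoment (a + 1) s := by
        rw [abs_of_nonpos (by nlinarith [mul_nonneg hs n1])]
        ring
      rw [h3]
      calc s ^ k * (Real.exp (-s ^ 2 / 2) *
            (s * gaussianMoment a s + 2 * gaussianMoment (a + 1) s))
          = (s ^ (k + 1) * Real.exp (-s ^ 2 / 2)) * gaussianMoment a s +
            2 * ((s ^ k * Real.exp (-s ^ 2 / 2)) * gaussianMoment (a + 1) s) := by ring
        _ ≤ _ := by
            refine add_le_add (mul_le_mul (pow_mul_exp_neg_sq_le (k + 1) hs)
              (gaussianMoment_le ha hs) n1 (by positivity)) (mul_le_mul_of_nonneg_left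
              (mul_le_mul (pow_mul_exp_neg_sq_le k hs) (gaussianMoment_le (by linarith) hs) n2
              (by positivity)) two_pos.le)

/-- The ladder operator `s - d/ds` moves `z` to `z + 1/2`, which reaches the parameters where the
integral diverges. It costs powers of `s`, hence decay against every power in the structure. -/
theorem IsParabolicCylinder.raise {z : ℝ} {f f' : ℝ → ℝ} (h : IsParabolicCylinder z f f') :
    IsParabolicCylinder (z + 1 / 2) (fun s => s * f s - f' s)
      (fun s => f s + s * f' s - (s ^ 2 - 4 * z) * f s) := by
  refine ⟨fun s => ?_, fun s => ?_, fun k => ?_⟩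
  · refine (((hasDerivAt_id' s).fun_mul (h.deriv_fst s)).fun_sub (h.deriv_snd s)).congr_deriv ?_
    ring
  · refine (((h.deriv_fst s).fun_add ((hasDerivAt_id' s).fun_mul (h.deriv_snd s))).fun_sub
      ((((hasDerivAt_pow 2 s).sub_const (4 * z))).fun_mul (h.deriv_fst s))).congr_deriv ?_
    push_cast
    ring
  · obtain ⟨C₀, h0⟩ := h.decay k
    obtain ⟨C₁, h1⟩ := h.decay (k + 1)
    obtain ⟨C₂, h2⟩ := h.decay (k + 2)
    refine ⟨max (C₁ + C₀) (C₀ + C₁ + C₂ + 4 * |z| * C₀), fun s hs => ⟨?_, ?_⟩⟩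
    · refine le_max_of_le_left ?_
      have := abs_sub (s * f s) (f' s)
      rw [abs_mul, abs_of_nonneg hs] at this
      calc s ^ k * |s * f s - f' s| ≤ s ^ k * (s * |f s| + |f' s|) := by gcongr
        _ = s ^ (k + 1) * |f s| + s ^ k * |f' s| := by ring
        _ ≤ _ := add_le_add (h1 s hs).1 (h0 s hs).2
    · refine le_max_of_le_right ?_
      have e : |f s + s * f' s - (s ^ 2 - 4 * z) * f s| ≤
          |f s| + s * |f' s| + (s ^ 2 * |f s| + 4 * |z| * |f s|) := by
        refine (abs_sub _ _).trans (add_le_add ((abs_add_le _ _).trans ?_) ?_)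
        · rw [abs_mul, abs_of_nonneg hs]
        · rw [abs_mul, ← add_mul]
          gcongr
          refine (abs_sub _ _).trans ?_
          rw [abs_of_nonneg (sq_nonneg s), abs_mul, abs_of_pos (four_pos)]
      calc s ^ k * |f s + s * f' s - (s ^ 2 - 4 * z) * f s|
          ≤ s ^ k * (|f s| + s * |f' s| + (s ^ 2 * |f s| + 4 * |z| * |f s|)) := by gcongr
        _ = s ^ k * |f s| + s ^ (k + 1) * |f' s| + s ^ (k + 2) * |f s| +
            4 * |z| * (s ^ k * |f s|) := by ring
        _ ≤ _ := by
            have := mul_le_mul_of_nonneg_left (h0 s hs).1 (show 0 ≤ 4 * |z| by positivity)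
            linarith [(h0 s hs).1, (h1 s hs).2, (h2 s hs).1]

/-- The functional equation for the entire function `1/Γ`; with value `0` at the poles of `Γ` no
exception is needed. -/
theorem one_div_Gamma_eq (s : ℝ) : 1 / Real.Gamma s = s / Real.Gamma (s + 1) := by
  rcases eq_or_ne s 0 with rfl | hs
  · simp
  · rw [Real.Gamma_add_one hs, div_mul_eq_div_div, div_self hs]

/-- Each ladder step exchanges value and derivative at `0` up to factors, and `one_div_Gamma_eq`
restores the form of the data with `c` doubled. -/
theorem exists_isParabolicCylinder_lt (n : ℕ) : ∀ z : ℝ, z < 1 / 4 + n / 2 →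
    ∃ f f' : ℝ → ℝ, ∃ c : ℝ, IsParabolicCylinder z f f' ∧ 0 < c ∧
      f 0 = c / Real.Gamma (3 / 4 - z) ∧ f' 0 = -(2 * c) / Real.Gamma (1 / 4 - z) := by
  induction n with
  | zero =>
    intro z hz
    have hz' : z < 1 / 4 := by simpa using hz
    have g1 : 0 < Real.Gamma (1 / 4 - z) := Real.Gamma_pos_of_pos (by linarith)
    have g3 : 0 < Real.Gamma (3 / 4 - z) := Real.Gamma_pos_of_pos (by linarith)
    refine ⟨_, _, 1 / 2 * Real.Gamma (1 / 4 - z) * Real.Gamma (3 / 4 - z),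
      isParabolicCylinder_gaussianMoment hz', by positivity, ?_, ?_⟩
    · simp only [gaussianMoment_zero (show -1 < -2 * z - 1 / 2 by linarith)]
      rw [show (-2 * z - 1 / 2 + 1) / 2 = 1 / 4 - z by ring, mul_div_cancel_right₀ _ g3.ne']
      simp
    · simp only [gaussianMoment_zero (show -1 < -2 * z - 1 / 2 + 1 by linarith)]
      rw [show (-2 * z - 1 / 2 + 1 + 1) / 2 = 3 / 4 - z by ring, eq_div_iff g1.ne']
      simp
      ring
  | succ n ih =>
    intro z hz
    obtain ⟨f, f', c, hf, hc, h0, h1⟩ := ih (z - 1 / 2) (by push_cast at hz; linarith)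
    have hr := hf.raise
    rw [sub_add_cancel] at hr
    refine ⟨_, _, 2 * c, hr, by positivity, ?_, ?_⟩
    · simp only [h1, show 1 / 4 - (z - 1 / 2) = 3 / 4 - z by ring]
      ring
    · simp only [h0]
      have := one_div_Gamma_eq (1 / 4 - z)
      rw [show 1 / 4 - z + 1 = 3 / 4 - (z - 1 / 2) by ring] at this
      rw [div_eq_mul_one_div (-(2 * (2 * c))), this]
      ring

theorem exists_isParabolicCylinder (z : ℝ) :
    ∃ f f' : ℝ → ℝ, ∃ c : ℝ, IsParabolicCylinder z f f' ∧ 0 < c ∧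
      f 0 = c / Real.Gamma (3 / 4 - z) ∧ f' 0 = -(2 * c) / Real.Gamma (1 / 4 - z) := by
  obtain ⟨n, hn⟩ := exists_nat_gt (2 * z)
  exact exists_isParabolicCylinder_lt n z (by linarith)

/-- Decay of orders `0` and `1` gives `(1 + s²) f² ≤ C₀² + C₁²`. -/
theorem IsParabolicCylinder.integrableOn_sq {z : ℝ} {f f' : ℝ → ℝ}
    (h : IsParabolicCylinder z f f') : IntegrableOn (fun s => f s ^ 2) (Ioi 0) := by
  obtain ⟨C₀, h0⟩ := h.decay 0
  obtain ⟨C₁, h1⟩ := h.decay 1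
  have hcont : Continuous f := continuous_iff_continuousAt.2 fun s => (h.deriv_fst s).continuousAt
  refine Integrable.mono' ((integrable_inv_one_add_sq.const_mul (C₀ ^ 2 + C₁ ^ 2)).integrableOn)
    (by fun_prop) ?_
  filter_upwards [ae_restrict_mem measurableSet_Ioi] with s hs
  have hs' : (0 : ℝ) < s := hs
  have e0 := (h0 s hs'.le).1
  have e1 := (h1 s hs'.le).1
  rw [pow_zero, one_mul] at e0
  rw [pow_one] at e1
  rw [Real.norm_of_nonneg (sq_nonneg _), ← div_eq_mul_inv, le_div_iff₀ (by positivity)]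
  have f0 := pow_le_pow_left₀ (abs_nonneg _) e0 2
  have f1 := pow_le_pow_left₀ (by positivity) e1 2
  rw [mul_pow, sq_abs] at f1
  rw [sq_abs] at f0
  linarith

/-- The solution of `u'' = (α⁴ x² - 4 α² z) u` that is square integrable at `+∞`, with its data at
`0` in terms of the angle function. -/
theorem IsAngleFunction.exists_decaying {θ : ℝ → ℝ} (hθ : IsAngleFunction θ) {α z : ℝ}
    (hα : 0 < α) (hz : 0 < z) :
    ∃ u u' : ℝ → ℝ, (∀ x, HasDerivAt u (u' x) x) ∧
      (∀ x, HasDerivAt u' ((α ^ 4 * x ^ 2 - 4 * α ^ 2 * z) * u x) x) ∧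
      u 0 = Real.cos (θ z) ∧ u' 0 = 2 * α * Real.sqrt z * Real.sin (θ z) ∧
      IntegrableOn (fun x => u x ^ 2) (Ioi 0) := by
  obtain ⟨f, f', c, hf, hc, h0, h1⟩ := exists_isParabolicCylinder z
  obtain ⟨r, hr, hr1, hr2⟩ := hθ.2.2 z hz.le
  -- The factor that turns the value at `0` into `cos (θ z)`, since `√z / Γ(3/4 - z) = r cos (θ z)`.
  set A := Real.sqrt z / (c * r) with hA
  have hlin (x : ℝ) : HasDerivAt (fun x : ℝ => α * x) α x := by
    simpa using (hasDerivAt_id x).const_mul α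
  refine ⟨fun x => A * f (α * x), fun x => A * (f' (α * x) * α), fun x => ?_, fun x => ?_,
    ?_, ?_, ?_⟩
  · exact (HasDerivAt.comp x (hf.deriv_fst (α * x)) (hlin x)).const_mul A
  · refine (((HasDerivAt.comp x (hf.deriv_snd (α * x)) (hlin x)).mul_const α).const_mul
      A).congr_deriv ?_
    ring
  · simp only [mul_zero, h0, hA]
    have e : Real.cos (θ z) = Real.sqrt z / Real.Gamma (3 / 4 - z) / r := by
      rw [← hr1]; field_simp
    rw [e]
    field_simp
  · simp only [mul_zero, h1, hA]
    have e : Real.sin (θ z) = -(1 / Real.Gamma (1 / 4 - z)) / r := by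
      rw [← hr2]; field_simp
    rw [e]
    field_simp
  · have := (integrableOn_Ioi_comp_mul_left_iff (fun s => f s ^ 2) 0 hα).2
      (by rw [mul_zero]; exact hf.integrableOn_sq)
    simp only [mul_pow]
    exact this.const_mul (A ^ 2)

/-! ### Square integrable solutions of `u'' = q u`: energy identities and Wronskians. -/

theorem not_integrableOn_Ioi_of_le {f : ℝ → ℝ} {b c : ℝ} (hc : 0 < c) (hf : ∀ x ∈ Ioi b, c ≤ f x) :
    ¬ IntegrableOn f (Ioi b) := by
  intro h
  have h1 : IntegrableOn (fun _ : ℝ => c) (Ioi b) := by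
    refine Integrable.mono' h (by fun_prop) ?_
    filter_upwards [ae_restrict_mem measurableSet_Ioi] with x hx
    rw [Real.norm_of_nonneg hc.le]
    exact hf x hx
  rw [integrableOn_const_iff] at h1
  simp [hc.ne'] at h1

theorem eqOn_Ici_of_hasDerivAt_zero {E : Type*} [NormedAddCommGroup E] [NormedSpace ℝ E]
    {f : ℝ → E} {a : ℝ} (hf : ∀ x, a ≤ x → HasDerivAt f 0 x) {x : ℝ} (hx : a ≤ x) : f x = f a :=
  constant_of_has_deriv_right_zero (a := a) (b := x)
    (fun y hy => (hf y hy.1).continuousAt.continuousWithinAt)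
    (fun y hy => (hf y hy.1).hasDerivWithinAt) x ⟨hx, le_rfl⟩

theorem hasDerivAt_star_mul {u u' : ℝ → ℂ} {q : ℂ} {x : ℝ} (h : HasDerivAt u (u' x) x)
    (h' : HasDerivAt u' (q * u x) x) :
    HasDerivAt (fun x => star (u x) * u' x)
      ((Complex.normSq (u' x) : ℂ) + q * (Complex.normSq (u x) : ℂ)) x := by
  refine (h.star.fun_mul h').congr_deriv ?_
  rw [Complex.normSq_eq_conj_mul_self, Complex.normSq_eq_conj_mul_self, Complex.star_def]
  ring

theorem hasDerivAt_re {f : ℝ → ℂ} {f' : ℂ} {x : ℝ} (h : HasDerivAt f f' x) :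
    HasDerivAt (fun x => (f x).re) f'.re x :=
  Complex.reCLM.hasFDerivAt.comp_hasDerivAt x h

theorem hasDerivAt_normSq {u : ℝ → ℂ} {u' : ℂ} {x : ℝ} (h : HasDerivAt u u' x) :
    HasDerivAt (fun x => Complex.normSq (u x)) (2 * (star (u x) * u').re) x := by
  have h1 := hasDerivAt_re (h.star.fun_mul h)
  have h2 : (fun x => (star (u x) * u x).re) = fun x => Complex.normSq (u x) := by
    funext y
    rw [Complex.star_def, ← Complex.normSq_eq_conj_mul_self, Complex.ofReal_re]
  rw [h2] at h1
  refine h1.congr_deriv ?_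
  simp
  ring

/-- A pair `(u, u')` solving `u'' = q u` on `[a, ∞)` with `u` square integrable there. -/
structure IsL2Solution (q : ℝ → ℂ) (a : ℝ) (u u' : ℝ → ℂ) : Prop where
  deriv_fst (x : ℝ) : a ≤ x → HasDerivAt u (u' x) x
  deriv_snd (x : ℝ) : a ≤ x → HasDerivAt u' (q x * u x) x
  integrable : IntegrableOn (fun x => Complex.normSq (u x)) (Ioi a)

theorem IsL2Solution.mono {q : ℝ → ℂ} {a b : ℝ} {u u' : ℝ → ℂ} (h : IsL2Solution q a u u')
    (hab : a ≤ b) : IsL2Solution q b u u' :=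
  ⟨fun x hx => h.deriv_fst x (hab.trans hx), fun x hx => h.deriv_snd x (hab.trans hx),
    h.integrable.mono_set (Ioi_subset_Ioi hab)⟩

theorem IsL2Solution.hasDerivAt_re_star_mul {q : ℝ → ℂ} {a : ℝ} {u u' : ℝ → ℂ}
    (h : IsL2Solution q a u u') {x : ℝ} (hx : a ≤ x) :
    HasDerivAt (fun x => (star (u x) * u' x).re)
      (Complex.normSq (u' x) + (q x).re * Complex.normSq (u x)) x := by
  refine (hasDerivAt_re (hasDerivAt_star_mul (h.deriv_fst x hx) (h.deriv_snd x hx))).congr_deriv ?_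
  simp

theorem IsL2Solution.monotoneOn {q : ℝ → ℂ} {a : ℝ} {u u' : ℝ → ℂ}
    (h : IsL2Solution q a u u') (hq : ∀ x, a ≤ x → 0 ≤ (q x).re) :
    MonotoneOn (fun x => (star (u x) * u' x).re) (Ici a) := by
  refine monotoneOn_of_deriv_nonneg (convex_Ici a)
    (fun x hx => (h.hasDerivAt_re_star_mul hx).continuousAt.continuousWithinAt)
    (fun x hx => (h.hasDerivAt_re_star_mul
      (interior_subset hx)).differentiableAt.differentiableWithinAt) fun x hx => ?_
  have hx' : a ≤ x := interior_subset hx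
  rw [(h.hasDerivAt_re_star_mul hx').deriv]
  have := Complex.normSq_nonneg (u x)
  have := Complex.normSq_nonneg (u' x)
  have := hq x hx'
  positivity

/-- `2 Re(ū u')` is the derivative of `|u|²`, and `Re(ū u')` is nondecreasing. Once positive it
stays positive, so `|u|²` would increase and could not be integrable. -/
theorem IsL2Solution.re_star_mul_nonpos {q : ℝ → ℂ} {a : ℝ} {u u' : ℝ → ℂ}
    (h : IsL2Solution q a u u') (hq : ∀ x, a ≤ x → 0 ≤ (q x).re) {x : ℝ} (hx : a ≤ x) :
    (star (u x) * u' x).re ≤ 0 := by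
  by_contra hcon
  push Not at hcon
  have hmono := h.monotoneOn hq
  have hs : StrictMonoOn (fun x => Complex.normSq (u x)) (Ici x) := by
    refine strictMonoOn_of_deriv_pos (convex_Ici x)
      (fun y hy => (hasDerivAt_normSq (h.deriv_fst y (hx.trans hy))).continuousAt.continuousWithinAt)
      fun y hy => ?_
    have hy' : x ≤ y := interior_subset hy
    rw [(hasDerivAt_normSq (h.deriv_fst y (hx.trans hy'))).deriv]
    have h1 := hmono (show x ∈ Ici a from hx) (show y ∈ Ici a from hx.trans hy') hy'
    simp only at h1
    linarith
  refine not_integrableOn_Ioi_of_le (f := fun x => Complex.normSq (u x)) (b := x + 1)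
    (c := Complex.normSq (u (x + 1))) ?_ (fun y hy => ?_)
    (h.integrable.mono_set (Ioi_subset_Ioi (by linarith)))
  · exact (Complex.normSq_nonneg _).trans_lt
      (hs self_mem_Ici (show x ≤ x + 1 by linarith) (by linarith))
  · have hy' : x + 1 < y := hy
    exact (hs (show x ≤ x + 1 by linarith) (show x ≤ y by linarith) hy').le

/-- `Re(ū u')` is nondecreasing and bounded above by `0`, so its derivative `|u'|² + Re q |u|²` is
integrable, and it dominates `|u'|²`. -/
theorem IsL2Solution.integrable_deriv {q : ℝ → ℂ} {a : ℝ} {u u' : ℝ → ℂ}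
    (h : IsL2Solution q a u u') (hq : ∀ x, a ≤ x → 0 ≤ (q x).re) :
    IntegrableOn (fun x => Complex.normSq (u' x)) (Ioi a) := by
  have hmono := h.monotoneOn hq
  set p := fun x => (star (u x) * u' x).re with hp
  have hlim : ∃ l, Filter.Tendsto p Filter.atTop (nhds l) := by
    have h1 : Monotone fun x => p (max a x) := fun x y hxy =>
      hmono (le_max_left a x) (le_max_left a y) (max_le_max le_rfl hxy)
    have h2 : BddAbove (range fun x => p (max a x)) := by
      refine ⟨0, ?_⟩
      rintro _ ⟨x, rfl⟩
      exact h.re_star_mul_nonpos hq (le_max_left a x)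
    refine ⟨_, (tendsto_atTop_ciSup h1 h2).congr' ?_⟩
    filter_upwards [Filter.eventually_ge_atTop a] with x hx
    rw [max_eq_right hx]
  obtain ⟨l, hl⟩ := hlim
  have hi := integrableOn_Ioi_deriv_of_nonneg' (fun x hx => h.hasDerivAt_re_star_mul hx)
    (fun x hx => add_nonneg (Complex.normSq_nonneg _)
      (mul_nonneg (hq x (le_of_lt hx)) (Complex.normSq_nonneg _))) hl
  refine Integrable.mono' hi ?_ ?_
  · refine ContinuousOn.aestronglyMeasurable (fun x hx => ?_) measurableSet_Ioi
    exact (hasDerivAt_normSq (h.deriv_snd x (le_of_lt hx))).continuousAt.continuousWithinAt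
  · filter_upwards [ae_restrict_mem measurableSet_Ioi] with x hx
    rw [Real.norm_of_nonneg (Complex.normSq_nonneg _)]
    have := mul_nonneg (hq x (le_of_lt hx)) (Complex.normSq_nonneg (u x))
    linarith

theorem integrable_mul_of_normSq {μ : Measure ℝ} {f g : ℝ → ℂ} (hf : AEStronglyMeasurable f μ)
    (hg : AEStronglyMeasurable g μ) (hf2 : Integrable (fun x => Complex.normSq (f x)) μ)
    (hg2 : Integrable (fun x => Complex.normSq (g x)) μ) : Integrable (fun x => f x * g x) μ := by
  simp only [Complex.normSq_eq_norm_sq] at hf2 hg2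
  exact ((memLp_two_iff_integrable_sq_norm hf).2 hf2).integrable_mul
    ((memLp_two_iff_integrable_sq_norm hg).2 hg2)

/-- Two solutions that are square integrable at `+∞` are linearly dependent. -/
theorem IsL2Solution.wronskian_eq_zero {q : ℝ → ℂ} {a b : ℝ} {u u' v v' : ℝ → ℂ}
    (hu : IsL2Solution q a u u') (hv : IsL2Solution q a v v') (hab : a ≤ b)
    (hq : ∀ x, b ≤ x → 0 ≤ (q x).re) : u a * v' a - u' a * v a = 0 := by
  have hW : ∀ x, a ≤ x → HasDerivAt (fun x => u x * v' x - u' x * v x) 0 x := by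
    intro x hx
    refine (((hu.deriv_fst x hx).fun_mul (hv.deriv_snd x hx)).fun_sub
      ((hu.deriv_snd x hx).fun_mul (hv.deriv_fst x hx))).congr_deriv ?_
    ring
  have hm {w w' : ℝ → ℂ} (h : IsL2Solution q a w w') :
      AEStronglyMeasurable w (volume.restrict (Ioi b)) ∧
      AEStronglyMeasurable w' (volume.restrict (Ioi b)) :=
    ⟨ContinuousOn.aestronglyMeasurable (fun x hx =>
      (h.deriv_fst x (hab.trans (le_of_lt hx))).continuousAt.continuousWithinAt) measurableSet_Ioi,
      ContinuousOn.aestronglyMeasurable (fun x hx =>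
      (h.deriv_snd x (hab.trans (le_of_lt hx))).continuousAt.continuousWithinAt) measurableSet_Ioi⟩
  have hub := hu.mono hab
  have hvb := hv.mono hab
  have hi : IntegrableOn (fun x => u x * v' x - u' x * v x) (Ioi b) :=
    (integrable_mul_of_normSq (hm hu).1 (hm hv).2 hub.integrable (hvb.integrable_deriv hq)).sub
      (integrable_mul_of_normSq (hm hu).2 (hm hv).1 (hub.integrable_deriv hq) hvb.integrable)
  -- The Wronskian is constant and integrable on a half-line, hence zero.
  by_contra hne
  refine not_integrableOn_Ioi_of_le (norm_pos_iff.2 hne) (fun x hx => ?_) hi.norm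
  have := eqOn_Ici_of_hasDerivAt_zero hW (hab.trans (le_of_lt hx))
  rw [this]

/-- Reflection carries the statements at `+∞` over to `-∞`. -/
theorem IsL2Solution.comp_neg {q u u' : ℝ → ℂ} (hd : ∀ x, HasDerivAt u (u' x) x)
    (hd' : ∀ x, HasDerivAt u' (q x * u x) x)
    (hi : Integrable fun x => Complex.normSq (u x)) (a : ℝ) :
    IsL2Solution (fun x => q (-x)) a (fun x => u (-x)) (fun x => -u' (-x)) := by
  refine ⟨fun x _ => ?_, fun x _ => ?_, hi.comp_neg.integrableOn⟩
  · exact ((hd (-x)).scomp x (hasDerivAt_neg x)).congr_deriv (by simp)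
  · exact ((hd' (-x)).scomp x (hasDerivAt_neg x)).fun_neg.congr_deriv (by simp)

theorem integrable_normSq_deriv {q u u' : ℝ → ℂ} {b : ℝ} (hd : ∀ x, HasDerivAt u (u' x) x)
    (hd' : ∀ x, HasDerivAt u' (q x * u x) x) (hi : Integrable fun x => Complex.normSq (u x))
    (hq : ∀ x, b ≤ |x| → 0 ≤ (q x).re) : Integrable fun x => Complex.normSq (u' x) := by
  wlog hb : 0 ≤ b generalizing b
  · exact this (b := 0) (fun x hx => hq x (by push Not at hb; linarith)) le_rfl
  have h1 : IntegrableOn (fun x => Complex.normSq (u' x)) (Ioi b) :=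
    IsL2Solution.integrable_deriv ⟨fun x _ => hd x, fun x _ => hd' x, hi.integrableOn⟩
      fun x hx => hq x (hx.trans (le_abs_self x))
  have h2 := (IsL2Solution.comp_neg hd hd' hi b).integrable_deriv
    fun x hx => hq (-x) (by rw [abs_neg]; exact hx.trans (le_abs_self x))
  simp only [Complex.normSq_neg] at h2
  have h2' : IntegrableOn (fun x => Complex.normSq (u' x)) (Iio (-b)) := by
    rw [← integrable_indicator_iff measurableSet_Ioi] at h2
    rw [← integrable_indicator_iff measurableSet_Iio]
    refine h2.comp_neg.congr (Filter.Eventually.of_forall fun x => ?_)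
    simp [indicator, lt_neg]
  have hc : Continuous u' := continuous_iff_continuousAt.2 fun x => (hd' x).continuousAt
  have h3 : IntegrableOn (fun x => Complex.normSq (u' x)) (Icc (-b) b) :=
    (Complex.continuous_normSq.comp hc).integrableOn_Icc
  rw [← integrableOn_univ]
  refine ((h2'.union h3).union h1).mono_set fun x _ => ?_
  simp only [mem_union, mem_Iio, mem_Icc, mem_Ioi]
  rcases lt_or_ge x (-b) with h | h
  · exact Or.inl (Or.inl h)
  · rcases le_or_gt x b with h' | h'
    · exact Or.inl (Or.inr ⟨h, h'⟩)
    · exact Or.inr h'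

/-- `Im(ū u')` is integrable with derivative `c|u|²`, so `c ∫|u|² = 0`. This makes eigenvalues real.
-/
theorem im_eq_zero_of_l2_solution {q u u' : ℝ → ℂ} {b c : ℝ} (hd : ∀ x, HasDerivAt u (u' x) x)
    (hd' : ∀ x, HasDerivAt u' (q x * u x) x) (hi : Integrable fun x => Complex.normSq (u x))
    (hq : ∀ x, b ≤ |x| → 0 ≤ (q x).re) (hc : ∀ x, (q x).im = c) (hne : ∃ x, u x ≠ 0) : c = 0 := by
  have hcu : Continuous u := continuous_iff_continuousAt.2 fun x => (hd x).continuousAt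
  have hcu' : Continuous u' := continuous_iff_continuousAt.2 fun x => (hd' x).continuousAt
  have h1 : Integrable fun x => star (u x) * u' x := by
    refine integrable_mul_of_normSq hcu.star.aestronglyMeasurable hcu'.aestronglyMeasurable ?_
      (integrable_normSq_deriv hd hd' hi hq)
    simpa using hi
  have h2 : ∀ x, HasDerivAt (fun x => (star (u x) * u' x).im) (c * Complex.normSq (u x)) x := by
    intro x
    refine (Complex.imCLM.hasFDerivAt.comp_hasDerivAt x
      (hasDerivAt_star_mul (hd x) (hd' x))).congr_deriv ?_
    simp [hc]
  have h3 := integral_eq_zero_of_hasDerivAt_of_integrable h2 (hi.const_mul c) h1.im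
  rw [integral_const_mul] at h3
  refine (mul_eq_zero.1 h3).resolve_right fun h4 => ?_
  obtain ⟨x, hx⟩ := hne
  have h5 := (integral_eq_zero_iff_of_nonneg (fun x => Complex.normSq_nonneg (u x)) hi).1 h4
  have h6 := (Continuous.ae_eq_iff_eq volume (Complex.continuous_normSq.comp hcu)
    continuous_zero).1 h5
  exact hx (Complex.normSq_eq_zero.1 (congrFun h6 x))

/-- The sign of `Re(ū u')` at both ends forces it to vanish, so `|u|²` is constant and integrable.
This excludes `E ≤ 0`. -/
theorem eq_zero_of_l2_solution {q u u' : ℝ → ℂ} (hd : ∀ x, HasDerivAt u (u' x) x)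
    (hd' : ∀ x, HasDerivAt u' (q x * u x) x) (hi : Integrable fun x => Complex.normSq (u x))
    (hq : ∀ x, 0 ≤ (q x).re) (x : ℝ) : u x = 0 := by
  have h1 (y : ℝ) : (star (u y) * u' y).re = 0 := by
    refine le_antisymm (IsL2Solution.re_star_mul_nonpos (q := q) (a := y)
      ⟨fun x _ => hd x, fun x _ => hd' x, hi.integrableOn⟩ (fun x _ => hq x) le_rfl) ?_
    have := (IsL2Solution.comp_neg hd hd' hi (-y)).re_star_mul_nonpos (fun x _ => hq (-x))
      (x := -y) le_rfl
    simp only [neg_neg, mul_neg, Complex.neg_re] at this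
    linarith
  have h2 (y : ℝ) : HasDerivAt (fun x => Complex.normSq (u x)) 0 y :=
    (hasDerivAt_normSq (hd y)).congr_deriv (by rw [h1, mul_zero])
  by_contra hne
  refine not_integrableOn_Ioi_of_le (b := x) (Complex.normSq_pos.2 hne) (fun y hy => ?_)
    hi.integrableOn
  exact (eqOn_Ici_of_hasDerivAt_zero (fun y _ => h2 y) (le_of_lt hy)).ge

/-! ### Global solutions and the eigenvalue problem of the operator. -/

/-- A pair `(u, u')` solving `u'' = q u` on the whole line. -/
structure IsGlobalSolution (q u u' : ℝ → ℂ) : Prop where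
  deriv_fst (x : ℝ) : HasDerivAt u (u' x) x
  deriv_snd (x : ℝ) : HasDerivAt u' (q x * u x) x

theorem IsGlobalSolution.continuous {q u u' : ℝ → ℂ} (h : IsGlobalSolution q u u') :
    Continuous u :=
  continuous_iff_continuousAt.2 fun x => (h.deriv_fst x).continuousAt

theorem IsGlobalSolution.isL2Solution {q u u' : ℝ → ℂ} (h : IsGlobalSolution q u u')
    (hi : Integrable fun x => Complex.normSq (u x)) (a : ℝ) : IsL2Solution q a u u' :=
  ⟨fun x _ => h.deriv_fst x, fun x _ => h.deriv_snd x, hi.integrableOn⟩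

theorem IsGlobalSolution.const_mul {q u u' : ℝ → ℂ} (h : IsGlobalSolution q u u') (c : ℂ) :
    IsGlobalSolution q (fun x => c * u x) (fun x => c * u' x) :=
  ⟨fun x => (h.deriv_fst x).const_mul c, fun x =>
    ((h.deriv_snd x).const_mul c).congr_deriv (by ring)⟩

theorem IsGlobalSolution.sub {q u u' v v' : ℝ → ℂ} (h : IsGlobalSolution q u u')
    (hv : IsGlobalSolution q v v') :
    IsGlobalSolution q (fun x => u x - v x) (fun x => u' x - v' x) :=
  ⟨fun x => (h.deriv_fst x).fun_sub (hv.deriv_fst x), fun x =>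
    ((h.deriv_snd x).fun_sub (hv.deriv_snd x)).congr_deriv (by ring)⟩

theorem IsGlobalSolution.eq_zero {q u u' : ℝ → ℂ} (h : IsGlobalSolution q u u')
    (hq : Continuous q) {a : ℝ} (ha : u a = 0) (ha' : u' a = 0) (x : ℝ) : u x = 0 := by
  set A := min a x - 1
  set B := max a x + 1
  obtain ⟨C, hC⟩ := (isCompact_Icc (a := A) (b := B)).exists_bound_of_continuousOn hq.continuousOn
  have hxm : x ∈ Ioo A B := ⟨by linarith [min_le_right a x], by linarith [le_max_right a x]⟩
  have ham : a ∈ Ioo A B := ⟨by linarith [min_le_left a x], by linarith [le_max_left a x]⟩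
  have hlip : ∀ t ∈ Ioo A B, LipschitzOnWith (Real.toNNReal (max 1 C))
      (fun p : ℂ × ℂ => (p.2, q t * p.1)) univ := by
    intro t ht
    refine (LipschitzWith.of_dist_le_mul fun p r => ?_).lipschitzOnWith
    rw [Real.coe_toNNReal _ (le_max_of_le_left zero_le_one), Prod.dist_eq, Prod.dist_eq]
    refine max_le ?_ ?_
    · calc dist p.2 r.2 = 1 * dist p.2 r.2 := (one_mul _).symm
        _ ≤ _ := by
            gcongr
            · exact le_max_left _ _
            · exact le_max_right _ _
    · simp only
      rw [dist_eq_norm, ← mul_sub, norm_mul, ← dist_eq_norm]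
      gcongr
      · exact (hC t (Ioo_subset_Icc_self ht)).trans (le_max_right _ _)
      · exact le_max_left _ _
  have := ODE_solution_unique_of_mem_Ioo (f := fun x => (u x, u' x)) (g := fun _ => 0)
    hlip ham (fun t _ => ⟨(h.deriv_fst t).prodMk (h.deriv_snd t), mem_univ _⟩)
    (fun t _ => ⟨(hasDerivAt_const t (0 : ℂ × ℂ)).congr_deriv (by ext <;> simp), mem_univ _⟩)
    (by simp [ha, ha']) hxm
  exact congrArg Prod.fst this

/-- Gluing two differentiable functions at a point where values and derivatives agree. -/
theorem hasDerivAt_ite_lt {f g f' g' : ℝ → ℂ} {a : ℝ} (hf : ∀ x, x ≤ a → HasDerivAt f (f' x) x)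
    (hg : ∀ x, a ≤ x → HasDerivAt g (g' x) x) (h : f a = g a) (h' : f' a = g' a) (x : ℝ) :
    HasDerivAt (fun x => if x < a then f x else g x) (if x < a then f' x else g' x) x := by
  rcases lt_trichotomy x a with hx | rfl | hx
  · rw [if_pos hx]
    refine (hf x hx.le).congr_of_eventuallyEq ?_
    filter_upwards [Iio_mem_nhds hx] with y hy
    exact if_pos hy
  · rw [if_neg (lt_irrefl x), ← hasDerivWithinAt_univ, ← Iic_union_Ici (a := x)]
    refine HasDerivWithinAt.union ?_ ?_
    · refine ((hf x le_rfl).hasDerivWithinAt.congr (fun y hy => ?_) ?_).congr_deriv h'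
      · rcases (show y ≤ x from hy).eq_or_lt with h1 | h1
        · simp [h1, h]
        · exact if_pos h1
      · simp [h]
    · exact (hg x le_rfl).hasDerivWithinAt.congr (fun y hy => if_neg (not_lt.2 hy)) (by simp)
  · rw [if_neg hx.not_gt]
    refine (hg x hx.le).congr_of_eventuallyEq ?_
    filter_upwards [Ioi_mem_nhds hx] with y hy
    exact if_neg (not_lt.2 (le_of_lt hy))

/-- The coefficient `q` for which `-(h² / 2m) u'' + V u = E u` reads `u'' = q u`. -/
noncomputable def schrodingerCoeff (h m : ℝ) (V : ℝ → ℝ) (E : ℂ) (x : ℝ) : ℂ :=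
  ((2 * m / h ^ 2 : ℝ) : ℂ) * ((V x : ℂ) - E)

theorem mem_unboundedEigenspace_iff_mem_graph {H : Type*} [AddCommGroup H] [Module ℂ H]
    (A : H →ₗ.[ℂ] H) (E : ℂ) (u : H) : u ∈ unboundedEigenspace A E ↔ (u, E • u) ∈ A.graph := by
  rw [LinearPMap.mem_graph_iff]
  exact ⟨fun ⟨w, h1, h2⟩ => ⟨w, h1, h2⟩, fun ⟨w, h1, h2⟩ => ⟨w, h1, h2⟩⟩

theorem isUnboundedEigenvalue_iff {H : Type*} [AddCommGroup H] [Module ℂ H]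
    (A : H →ₗ.[ℂ] H) (E : ℂ) :
    IsUnboundedEigenvalue A E ↔ ∃ u ∈ unboundedEigenspace A E, u ≠ 0 := by
  constructor
  · rintro ⟨u, h1, h2⟩
    exact ⟨u, ⟨u, rfl, h2⟩, h1⟩
  · rintro ⟨_, ⟨u, rfl, h2⟩, h1⟩
    exact ⟨u, h1, h2⟩

/-- Elliptic regularity in dimension one: `v''` equals the continuous function `q v` almost
everywhere, so `v'` is its integral and the equation holds pointwise. -/
theorem mem_unboundedEigenspace_schrodingerOp {h m : ℝ} {V : ℝ → ℝ} (hh : h ≠ 0) (hm : m ≠ 0)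
    (hV : Continuous V) (E : ℂ) (u : L2R) :
    u ∈ unboundedEigenspace (schrodingerOp h m V) E ↔
      ∃ v v' : ℝ → ℂ, IsGlobalSolution (schrodingerCoeff h m V E) v v' ∧ u =ᵐ[volume] v := by
  rw [mem_unboundedEigenspace_iff_mem_graph, schrodingerOp_graph]
  have hhc : (h : ℂ) ≠ 0 := by exact_mod_cast hh
  have hmc : (m : ℂ) ≠ 0 := by exact_mod_cast hm
  have hq : Continuous (schrodingerCoeff h m V E) := by
    unfold schrodingerCoeff
    fun_prop
  constructor
  · rintro ⟨v, g, hs, hv, hg⟩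
    simp only at hv hg
    have hgq : g =ᵐ[volume] fun x => schrodingerCoeff h m V E x * v x := by
      filter_upwards [hv, hg, Lp.coeFn_smul E u] with x h1 h2 h3
      rw [h3, Pi.smul_apply, h1, smul_eq_mul] at h2
      unfold schrodingerCoeff
      push_cast at h2 ⊢
      field_simp at h2 ⊢
      linear_combination h2
    have hcont : Continuous fun x => schrodingerCoeff h m V E x * v x := hq.mul hs.1.continuous
    have hd : deriv v = fun y => (∫ t in (0 : ℝ)..y, schrodingerCoeff h m V E t * v t) +
        deriv v 0 := by
      funext y
      rw [← intervalIntegral.integral_congr_ae (hgq.mono fun x hx _ => hx), ← hs.2.2 0 y]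
      ring
    refine ⟨v, deriv v, ⟨fun x => (hs.1 x).hasDerivAt, fun x => ?_⟩, hv⟩
    rw [hd]
    exact (hcont.integral_hasStrictDerivAt 0 x).hasDerivAt.add_const _
  · rintro ⟨v, v', hv, huv⟩
    have hcont : Continuous fun x => schrodingerCoeff h m V E x * v x := hq.mul hv.continuous
    have hd : deriv v = v' := funext fun x => (hv.deriv_fst x).deriv
    refine ⟨v, fun x => schrodingerCoeff h m V E x * v x,
      ⟨fun x => (hv.deriv_fst x).differentiableAt, hcont.locallyIntegrable, fun a b => ?_⟩, huv, ?_⟩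
    · rw [hd]
      exact (intervalIntegral.integral_eq_sub_of_hasDerivAt (fun x _ => hv.deriv_snd x)
        (hcont.intervalIntegrable a b)).symm
    · filter_upwards [huv, Lp.coeFn_smul E u] with x h1 h3
      rw [h3, Pi.smul_apply, h1, smul_eq_mul]
      unfold schrodingerCoeff
      push_cast
      field_simp
      ring

theorem integrable_normSq_of_ae_eq {u : L2R} {v : ℝ → ℂ} (h : u =ᵐ[volume] v) :
    Integrable fun x => Complex.normSq (v x) := by
  have h1 : MemLp v 2 volume := (memLp_congr_ae h).1 (Lp.memLp u)
  simp only [Complex.normSq_eq_norm_sq]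
  exact (memLp_two_iff_integrable_sq_norm h1.1).1 h1

theorem exists_L2R_ae_eq {v : ℝ → ℂ} (hv : Continuous v)
    (hi : Integrable fun x => Complex.normSq (v x)) : ∃ u : L2R, u =ᵐ[volume] v := by
  simp only [Complex.normSq_eq_norm_sq] at hi
  have h1 := (memLp_two_iff_integrable_sq_norm hv.aestronglyMeasurable).2 hi
  exact ⟨h1.toLp v, h1.coeFn_toLp⟩

theorem L2R_ne_zero_iff {u : L2R} {v : ℝ → ℂ} (h : u =ᵐ[volume] v) (hv : Continuous v) :
    u ≠ 0 ↔ ∃ x, v x ≠ 0 := by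
  rw [ne_eq, Lp.eq_zero_iff_ae_eq_zero]
  constructor
  · intro h0
    by_contra hcon
    push Not at hcon
    exact h0 (h.trans (Filter.Eventually.of_forall hcon))
  · rintro ⟨x, hx⟩ h0
    exact hx (congrFun ((Continuous.ae_eq_iff_eq volume hv continuous_zero).1 (h.symm.trans h0)) x)

theorem isUnboundedEigenvalue_schrodingerOp {h m : ℝ} {V : ℝ → ℝ} (hh : h ≠ 0) (hm : m ≠ 0)
    (hV : Continuous V) (E : ℂ) :
    IsUnboundedEigenvalue (schrodingerOp h m V) E ↔
      ∃ v v' : ℝ → ℂ, IsGlobalSolution (schrodingerCoeff h m V E) v v' ∧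
        (Integrable fun x => Complex.normSq (v x)) ∧ ∃ x, v x ≠ 0 := by
  rw [isUnboundedEigenvalue_iff]
  constructor
  · rintro ⟨u, hu, hne⟩
    obtain ⟨v, v', hv, huv⟩ := (mem_unboundedEigenspace_schrodingerOp hh hm hV E u).1 hu
    exact ⟨v, v', hv, integrable_normSq_of_ae_eq huv, (L2R_ne_zero_iff huv hv.continuous).1 hne⟩
  · rintro ⟨v, v', hv, hi, hne⟩
    obtain ⟨u, hu⟩ := exists_L2R_ae_eq hv.continuous hi
    exact ⟨u, (mem_unboundedEigenspace_schrodingerOp hh hm hV E u).2 ⟨v, v', hv, hu⟩,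
      (L2R_ne_zero_iff hu hv.continuous).2 hne⟩

/-! ### The potential; eigenvalues are real and positive. -/

theorem bathtubPotential_eq {m ℓ ωm ωp : ℝ} (hℓ : 0 ≤ ℓ) (x : ℝ) :
    bathtubPotential m ℓ ωm ωp x =
      1 / 2 * m * ωm ^ 2 * min x 0 ^ 2 + 1 / 2 * m * ωp ^ 2 * max (x - ℓ) 0 ^ 2 := by
  unfold bathtubPotential
  split_ifs with h1 h2
  · rw [min_eq_left h1.le, max_eq_right (by linarith)]
    ring
  · rw [min_eq_right (by linarith), max_eq_right (by linarith)]
    ring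
  · rw [min_eq_right (by linarith), max_eq_left (by linarith)]
    ring

theorem continuous_bathtubPotential {m ℓ ωm ωp : ℝ} (hℓ : 0 ≤ ℓ) :
    Continuous (bathtubPotential m ℓ ωm ωp) := by
  rw [funext (bathtubPotential_eq hℓ)]
  fun_prop

theorem bathtubPotential_nonneg {m ℓ ωm ωp : ℝ} (hm : 0 < m) (hℓ : 0 ≤ ℓ) (x : ℝ) :
    0 ≤ bathtubPotential m ℓ ωm ωp x := by
  rw [bathtubPotential_eq hℓ]
  positivity

theorem exists_le_bathtubPotential {m ℓ ωm ωp : ℝ} (hm : 0 < m) (hℓ : 0 ≤ ℓ) (hωm : 0 < ωm)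
    (hωp : 0 < ωp) (e : ℝ) : ∃ b, ∀ x, b ≤ |x| → e ≤ bathtubPotential m ℓ ωm ωp x := by
  have hM : 0 < 1 / 2 * m * ωm ^ 2 := by positivity
  have hP : 0 < 1 / 2 * m * ωp ^ 2 := by positivity
  have key : ∀ c : ℝ, 0 < c → ∀ y : ℝ, 1 + |e| / c ≤ y → e ≤ c * y ^ 2 := by
    intro c hc y hy
    have h0 : 0 ≤ |e| / c := by positivity
    have h1 : y ≤ y ^ 2 := by nlinarith
    calc e ≤ |e| := le_abs_self e
      _ = c * (|e| / c) := by field_simp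
      _ ≤ c * y ^ 2 := mul_le_mul_of_nonneg_left (by linarith) hc.le
  have h1 : 0 ≤ |e| / (1 / 2 * m * ωm ^ 2) := by positivity
  have h2 : 0 ≤ |e| / (1 / 2 * m * ωp ^ 2) := by positivity
  refine ⟨ℓ + 1 + |e| / (1 / 2 * m * ωm ^ 2) + |e| / (1 / 2 * m * ωp ^ 2), fun x hx => ?_⟩
  rw [bathtubPotential_eq hℓ]
  rcases le_or_gt 0 x with h | h
  · rw [abs_of_nonneg h] at hx
    rw [max_eq_left (by linarith)]
    have := key _ hP (x - ℓ) (by linarith)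
    have : 0 ≤ 1 / 2 * m * ωm ^ 2 * min x 0 ^ 2 := by positivity
    linarith
  · rw [abs_of_neg h] at hx
    rw [min_eq_left h.le]
    have := key _ hM (-x) (by linarith)
    rw [neg_sq] at this
    have : 0 ≤ 1 / 2 * m * ωp ^ 2 * max (x - ℓ) 0 ^ 2 := by positivity
    linarith

theorem IsUnboundedEigenvalue.real_pos {h m ℓ ωm ωp : ℝ} (hh : 0 < h) (hm : 0 < m) (hℓ : 0 ≤ ℓ)
    (hωm : 0 < ωm) (hωp : 0 < ωp) {E : ℂ}
    (hE : IsUnboundedEigenvalue (bathtubOp h m ℓ ωm ωp) E) : E = (E.re : ℂ) ∧ 0 < E.re := by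
  obtain ⟨v, v', hv, hi, hne⟩ := (isUnboundedEigenvalue_schrodingerOp hh.ne' hm.ne'
    (continuous_bathtubPotential hℓ) E).1 hE
  have hc : 0 < 2 * m / h ^ 2 := by positivity
  have hre (x : ℝ) : (schrodingerCoeff h m (bathtubPotential m ℓ ωm ωp) E x).re =
      2 * m / h ^ 2 * (bathtubPotential m ℓ ωm ωp x - E.re) := by
    unfold schrodingerCoeff
    rw [Complex.re_ofReal_mul]
    simp
  have him (x : ℝ) : (schrodingerCoeff h m (bathtubPotential m ℓ ωm ωp) E x).im =
      2 * m / h ^ 2 * -E.im := by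
    unfold schrodingerCoeff
    rw [Complex.im_ofReal_mul]
    simp
  obtain ⟨b, hb⟩ := exists_le_bathtubPotential hm hℓ hωm hωp E.re
  have h0 := im_eq_zero_of_l2_solution hv.deriv_fst hv.deriv_snd hi (b := b)
    (fun x hx => by rw [hre]; exact mul_nonneg hc.le (by linarith [hb x hx])) him hne
  have h1 : E.im = 0 := by simpa [hc.ne', hh.ne', hm.ne'] using h0
  refine ⟨Complex.ext rfl h1, ?_⟩
  by_contra hcon
  push Not at hcon
  obtain ⟨x, hx⟩ := hne
  refine hx (eq_zero_of_l2_solution hv.deriv_fst hv.deriv_snd hi (fun y => ?_) x)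
  rw [hre]
  exact mul_nonneg hc.le (by linarith [bathtubPotential_nonneg hm hℓ (ωm := ωm) (ωp := ωp) y])

/-! ### Matching at the two junctions. -/

theorem hasDerivAt_ofReal_comp_sub {u : ℝ → ℝ} {u' x a : ℝ} (h : HasDerivAt u u' (x - a)) :
    HasDerivAt (fun x => ((u (x - a) : ℝ) : ℂ)) (u' : ℂ) x := by
  have h1 : HasDerivAt (fun x : ℝ => x - a) 1 x := (hasDerivAt_id' x).sub_const a
  have h2 := (h.comp x h1).ofReal_comp
  rw [mul_one] at h2
  exact h2

/-- The data at `a` of a solution that is square integrable at `+∞`, for a coefficient that is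
quadratic on `[a, ∞)`. -/
theorem IsAngleFunction.data_of_isL2Solution {θ : ℝ → ℝ} (hθ : IsAngleFunction θ) {α z k a : ℝ}
    (hα : 0 < α) (hz : 0 < z) (hk : 2 * α * Real.sqrt z = k) {q v v' : ℝ → ℂ}
    (hq : ∀ x, a ≤ x → q x = ((α ^ 4 * (x - a) ^ 2 - k ^ 2 : ℝ) : ℂ))
    (hv : IsL2Solution q a v v') : v' a * Real.cos (θ z) = v a * (k * Real.sin (θ z)) := by
  have hk2 : k ^ 2 = 4 * α ^ 2 * z := by
    rw [← hk, mul_pow, Real.sq_sqrt hz.le]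
    ring
  obtain ⟨u, u', h1, h2, h3, h4, h5⟩ := hθ.exists_decaying hα hz
  have hu : IsL2Solution q a (fun x => ((u (x - a) : ℝ) : ℂ)) (fun x => ((u' (x - a) : ℝ) : ℂ)) := by
    refine ⟨fun x _ => hasDerivAt_ofReal_comp_sub (h1 _), fun x hx => ?_, ?_⟩
    · refine (hasDerivAt_ofReal_comp_sub (h2 _)).congr_deriv ?_
      rw [hq x hx, hk2]
      push_cast
      ring
    · simp only [Complex.normSq_ofReal, ← pow_two]
      rw [← integrable_indicator_iff measurableSet_Ioi] at h5 ⊢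
      refine (h5.comp_sub_right a).congr (Filter.Eventually.of_forall fun x => ?_)
      simp [indicator]
  have hk0 : 0 < k := by rw [← hk]; positivity
  -- `a + k / α²` is the turning point, beyond which `α⁴(x - a)² ≥ k²`.
  have hw := hu.wronskian_eq_zero hv (b := a + k / α ^ 2) (by simp; positivity) fun x hx => ?_
  · simp only [sub_self, h3, h4, hk] at hw
    push_cast at hw ⊢
    linear_combination hw
  · have h6 : 0 ≤ k / α ^ 2 := by positivity
    rw [hq x (by linarith), Complex.ofReal_re]
    have h7 : k ≤ α ^ 2 * (x - a) := by
      rw [← div_le_iff₀' (by positivity)]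
      linarith
    have := pow_le_pow_left₀ hk0.le h7 2
    nlinarith

/-- The coefficient `q` is quadratic on the left of `0`, constant on `[0, ℓ]`, and quadratic on the
right of `ℓ`. -/
structure IsBathtubCoeff (q : ℝ → ℂ) (ℓ k α y β z : ℝ) : Prop where
  continuous : Continuous q
  length_nonneg : 0 ≤ ℓ
  left_pos : 0 < α
  left_param_pos : 0 < y
  left_freq : 2 * α * Real.sqrt y = k
  right_pos : 0 < β
  right_param_pos : 0 < z
  right_freq : 2 * β * Real.sqrt z = k
  left (x : ℝ) : x ≤ 0 → q x = ((α ^ 4 * x ^ 2 - k ^ 2 : ℝ) : ℂ)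
  middle (x : ℝ) : 0 ≤ x → x ≤ ℓ → q x = ((-k ^ 2 : ℝ) : ℂ)
  right (x : ℝ) : ℓ ≤ x → q x = ((β ^ 4 * (x - ℓ) ^ 2 - k ^ 2 : ℝ) : ℂ)

section

variable {θ : ℝ → ℝ} {q v v' w w' : ℝ → ℂ} {ℓ k α y β z : ℝ}

theorem IsBathtubCoeff.freq_pos (hq : IsBathtubCoeff q ℓ k α y β z) : 0 < k := by
  have := hq.left_pos
  have := Real.sqrt_pos.2 hq.left_param_pos
  rw [← hq.left_freq]
  positivity

theorem IsBathtubCoeff.right_data (hq : IsBathtubCoeff q ℓ k α y β z) (hθ : IsAngleFunction θ)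
    (hv : IsGlobalSolution q v v') (hi : Integrable fun x => Complex.normSq (v x)) :
    v' ℓ * Real.cos (θ z) = v ℓ * (k * Real.sin (θ z)) :=
  hθ.data_of_isL2Solution hq.right_pos hq.right_param_pos hq.right_freq hq.right
    (hv.isL2Solution hi ℓ)

theorem IsBathtubCoeff.left_data (hq : IsBathtubCoeff q ℓ k α y β z) (hθ : IsAngleFunction θ)
    (hv : IsGlobalSolution q v v') (hi : Integrable fun x => Complex.normSq (v x)) :
    -v' 0 * Real.cos (θ y) = v 0 * (k * Real.sin (θ y)) := by
  have := hθ.data_of_isL2Solution (a := 0) hq.left_pos hq.left_param_pos hq.left_freq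
    (q := fun x => q (-x)) (fun x hx => by rw [hq.left (-x) (by linarith), sub_zero, neg_sq])
    (IsL2Solution.comp_neg hv.deriv_fst hv.deriv_snd hi 0)
  simpa using this

theorem hasDerivAt_cos_affine (k c x : ℝ) :
    HasDerivAt (fun x => ((Real.cos (k * x + c) : ℝ) : ℂ))
      ((-(k * Real.sin (k * x + c)) : ℝ) : ℂ) x := by
  have h1 : HasDerivAt (fun x : ℝ => k * x + c) k x := by
    simpa using ((hasDerivAt_id' x).const_mul k).add_const c
  exact (h1.cos.congr_deriv (by ring)).ofReal_comp

theorem hasDerivAt_sin_affine (k c x : ℝ) :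
    HasDerivAt (fun x => ((-(k * Real.sin (k * x + c)) : ℝ) : ℂ))
      (((-k ^ 2 : ℝ) : ℂ) * ((Real.cos (k * x + c) : ℝ) : ℂ)) x := by
  have h1 : HasDerivAt (fun x : ℝ => k * x + c) k x := by
    simpa using ((hasDerivAt_id' x).const_mul k).add_const c
  refine ((h1.sin.const_mul k).neg.ofReal_comp).congr_deriv ?_
  push_cast
  ring

/-- The Wronskian with `cos(kx + c)` is constant on the flat part and carries data from `ℓ` to `0`;
`c` is left free to fit the data at `ℓ`. -/
theorem IsBathtubCoeff.wronskian_cos (hq : IsBathtubCoeff q ℓ k α y β z)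
    (hv : IsGlobalSolution q v v') (c : ℝ) :
    v ℓ * ((-(k * Real.sin (k * ℓ + c)) : ℝ) : ℂ) - v' ℓ * ((Real.cos (k * ℓ + c) : ℝ) : ℂ) =
      v 0 * ((-(k * Real.sin c) : ℝ) : ℂ) - v' 0 * ((Real.cos c : ℝ) : ℂ) := by
  have hW : ∀ x, 0 ≤ x → x ≤ ℓ → HasDerivAt (fun x =>
      v x * ((-(k * Real.sin (k * x + c)) : ℝ) : ℂ) - v' x * ((Real.cos (k * x + c) : ℝ) : ℂ))
      0 x := by
    intro x hx hx'
    refine (((hv.deriv_fst x).fun_mul (hasDerivAt_sin_affine k c x)).fun_sub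
      ((hv.deriv_snd x).fun_mul (hasDerivAt_cos_affine k c x))).congr_deriv ?_
    rw [hq.middle x hx hx']
    ring
  have := constant_of_has_deriv_right_zero (a := 0) (b := ℓ)
    (fun x hx => (hW x hx.1 hx.2).continuousAt.continuousWithinAt)
    (fun x hx => (hW x hx.1 hx.2.le).hasDerivWithinAt) ℓ ⟨hq.length_nonneg, le_rfl⟩
  simpa using this

/-- The conditions from the left and, transported to `0`, from the right are two linear equations in
`(v 0, v' 0)` with determinant `k sin(kℓ + θ y + θ z)` up to sign. A nonzero solution needs it to
vanish. -/
theorem IsBathtubCoeff.sin_eq_zero (hq : IsBathtubCoeff q ℓ k α y β z) (hθ : IsAngleFunction θ)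
    (hv : IsGlobalSolution q v v') (hi : Integrable fun x => Complex.normSq (v x))
    (hne : ∃ x, v x ≠ 0) : Real.sin (k * ℓ + θ y + θ z) = 0 := by
  have h1 := hq.right_data hθ hv hi
  have h2 := hq.left_data hθ hv hi
  -- With this `c` the cosine has data `cos (θ z)`, `k sin (θ z)` at `ℓ`, those of the decaying
  -- solution.
  have h3 := hq.wronskian_cos hv (-(k * ℓ) - θ z)
  rw [show k * ℓ + (-(k * ℓ) - θ z) = -θ z by ring,
    show -(k * ℓ) - θ z = -(k * ℓ + θ z) by ring, Real.sin_neg, Real.cos_neg, Real.sin_neg,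
    Real.cos_neg] at h3
  have hk : (k : ℂ) ≠ 0 := by exact_mod_cast hq.freq_pos.ne'
  have hs : Real.sin (k * ℓ + θ y + θ z) = Real.sin (k * ℓ + θ z) * Real.cos (θ y) +
      Real.cos (k * ℓ + θ z) * Real.sin (θ y) := by
    rw [← Real.sin_add]
    ring_nf
  have h4 : v 0 * (k * Real.sin (k * ℓ + θ z)) = v' 0 * Real.cos (k * ℓ + θ z) := by
    push_cast at h1 h3 ⊢
    linear_combination -h1 - h3
  by_contra hcon
  have hcon' : ((Real.sin (k * ℓ + θ y + θ z) : ℝ) : ℂ) ≠ 0 := by exact_mod_cast hcon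
  rw [hs, Complex.ofReal_add, Complex.ofReal_mul, Complex.ofReal_mul] at hcon'
  obtain ⟨x, hx⟩ := hne
  refine hx (hv.eq_zero hq.continuous (a := 0) ?_ ?_ x)
  · refine (mul_eq_zero.1 (?_ : v 0 * (k * (Real.sin (k * ℓ + θ z) * Real.cos (θ y) +
      Real.cos (k * ℓ + θ z) * Real.sin (θ y))) = 0)).resolve_right (mul_ne_zero hk hcon')
    linear_combination (Real.cos (θ y) : ℂ) * h4 - (Real.cos (k * ℓ + θ z) : ℂ) * h2
  · refine (mul_eq_zero.1 (?_ : v' 0 * ((Real.sin (k * ℓ + θ z) * Real.cos (θ y) +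
      Real.cos (k * ℓ + θ z) * Real.sin (θ y))) = 0)).resolve_right hcon'
    linear_combination -(Real.sin (θ y) : ℂ) * h4 - (Real.sin (k * ℓ + θ z) : ℂ) * h2

/-- The data at `ℓ` of an `L²` solution are a multiple of `(cos (θ z), k sin (θ z))`; by uniqueness
for the initial value problem the multiples determine the solutions. -/
theorem IsBathtubCoeff.exists_eq_smul (hq : IsBathtubCoeff q ℓ k α y β z)
    (hθ : IsAngleFunction θ) (hv : IsGlobalSolution q v v')
    (hi : Integrable fun x => Complex.normSq (v x)) (hne : ∃ x, v x ≠ 0)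
    (hw : IsGlobalSolution q w w') (hiw : Integrable fun x => Complex.normSq (w x)) :
    ∃ c : ℂ, ∀ x, c * v x = w x := by
  have h1 := hq.right_data hθ hv hi
  have h2 := hq.right_data hθ hw hiw
  have hk : (k : ℂ) ≠ 0 := by exact_mod_cast hq.freq_pos.ne'
  have hcs : (Real.cos (θ z) : ℂ) ^ 2 + (Real.sin (θ z) : ℂ) ^ 2 = 1 := by
    exact_mod_cast Real.cos_sq_add_sin_sq (θ z)
  have repr : ∀ {u u' : ℝ → ℂ}, u' ℓ * Real.cos (θ z) = u ℓ * (k * Real.sin (θ z)) →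
      u ℓ = (u ℓ * Real.cos (θ z) + u' ℓ * Real.sin (θ z) / k) * Real.cos (θ z) ∧
      u' ℓ = (u ℓ * Real.cos (θ z) + u' ℓ * Real.sin (θ z) / k) * (k * Real.sin (θ z)) := by
    intro u u' h
    constructor
    · field_simp
      linear_combination -(Real.sin (θ z) : ℂ) * h - u ℓ * k * hcs
    · field_simp
      linear_combination (Real.cos (θ z) : ℂ) * h - u' ℓ * hcs
  obtain ⟨a1, a2⟩ := repr h1
  obtain ⟨b1, b2⟩ := repr h2
  set c := v ℓ * Real.cos (θ z) + v' ℓ * Real.sin (θ z) / k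
  set d := w ℓ * Real.cos (θ z) + w' ℓ * Real.sin (θ z) / k
  have hc : c ≠ 0 := by
    intro hc
    obtain ⟨x, hx⟩ := hne
    exact hx (hv.eq_zero hq.continuous (a := ℓ) (by rw [a1, hc, zero_mul])
      (by rw [a2, hc, zero_mul]) x)
  refine ⟨d / c, fun x => sub_eq_zero.1 (((hv.const_mul (d / c)).sub hw).eq_zero hq.continuous
    (a := ℓ) ?_ ?_ x)⟩
  · rw [a1, b1]
    field_simp
    ring
  · rw [a2, b2]
    field_simp
    ring

/-- Glue the reflected left solution, `cos(kx + θ y)`, and a multiple `ε` of the right solution. -/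
theorem IsBathtubCoeff.exists_solution (hq : IsBathtubCoeff q ℓ k α y β z)
    (hθ : IsAngleFunction θ) (hs : Real.sin (k * ℓ + θ y + θ z) = 0) :
    ∃ v v' : ℝ → ℂ, IsGlobalSolution q v v' ∧
      (Integrable fun x => Complex.normSq (v x)) ∧ ∃ x, v x ≠ 0 := by
  obtain ⟨f, f', f1, f2, f3, f4, f5⟩ := hθ.exists_decaying hq.left_pos hq.left_param_pos
  obtain ⟨g, g', g1, g2, g3, g4, g5⟩ := hθ.exists_decaying hq.right_pos hq.right_param_pos
  rw [hq.left_freq] at f4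
  rw [hq.right_freq] at g4
  have hkα : k ^ 2 = 4 * α ^ 2 * y := by
    rw [← hq.left_freq, mul_pow, Real.sq_sqrt hq.left_param_pos.le]
    ring
  have hkβ : k ^ 2 = 4 * β ^ 2 * z := by
    rw [← hq.right_freq, mul_pow, Real.sq_sqrt hq.right_param_pos.le]
    ring
  have hk := hq.freq_pos
  -- The sine of this angle is `0`, so `ε = ±1`; it is the sign needed at `ℓ`.
  obtain ⟨ε, hε⟩ : ∃ ε, ε = Real.cos (k * ℓ + θ y + θ z) := ⟨_, rfl⟩
  have e1 : Real.cos (k * ℓ + θ y) = ε * Real.cos (θ z) := by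
    rw [show k * ℓ + θ y = k * ℓ + θ y + θ z - θ z by ring, Real.cos_sub, hs, hε]
    ring
  have e2 : Real.sin (k * ℓ + θ y) = -(ε * Real.sin (θ z)) := by
    rw [show k * ℓ + θ y = k * ℓ + θ y + θ z - θ z by ring, Real.sin_sub, hs, hε]
    ring
  let L : ℝ → ℂ := fun x => ((f (-x) : ℝ) : ℂ)
  let L' : ℝ → ℂ := fun x => ((-f' (-x) : ℝ) : ℂ)
  let M : ℝ → ℂ := fun x => ((Real.cos (k * x + θ y) : ℝ) : ℂ)
  let M' : ℝ → ℂ := fun x => ((-(k * Real.sin (k * x + θ y)) : ℝ) : ℂ)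
  let R : ℝ → ℂ := fun x => (ε : ℂ) * ((g (x - ℓ) : ℝ) : ℂ)
  let R' : ℝ → ℂ := fun x => (ε : ℂ) * ((g' (x - ℓ) : ℝ) : ℂ)
  let N : ℝ → ℂ := fun x => if x < ℓ then M x else R x
  let N' : ℝ → ℂ := fun x => if x < ℓ then M' x else R' x
  have hL (x : ℝ) : HasDerivAt L (L' x) x := by
    have := ((f1 (-x)).comp x (hasDerivAt_neg x)).ofReal_comp
    exact this.congr_deriv (by simp [L'])
  have hL' (x : ℝ) (hx : x ≤ 0) : HasDerivAt L' (q x * L x) x := by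
    have := (((f2 (-x)).comp x (hasDerivAt_neg x)).neg).ofReal_comp
    refine this.congr_deriv ?_
    rw [hq.left x hx, hkα]
    simp [L]
  have hM (x : ℝ) : HasDerivAt M (M' x) x := hasDerivAt_cos_affine k (θ y) x
  have hR (x : ℝ) : HasDerivAt R (R' x) x := (hasDerivAt_ofReal_comp_sub (g1 _)).const_mul _
  have hR' (x : ℝ) (hx : ℓ ≤ x) : HasDerivAt R' (q x * R x) x := by
    refine ((hasDerivAt_ofReal_comp_sub (g2 _)).const_mul (ε : ℂ)).congr_deriv ?_
    rw [hq.right x hx, hkβ]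
    simp only [R]
    push_cast
    ring
  have mr : M ℓ = R ℓ := by
    simp only [M, R, e1, g3, sub_self, Complex.ofReal_mul]
  have mr' : M' ℓ = R' ℓ := by
    simp only [M', R', e2, g4, sub_self]
    push_cast
    ring
  have hN (x : ℝ) : HasDerivAt N (N' x) x :=
    hasDerivAt_ite_lt (fun x _ => hM x) (fun x _ => hR x) mr mr' x
  have hNM {x : ℝ} (hx : x ≤ ℓ) : N x = M x := by
    rcases hx.eq_or_lt with h | h
    · simp only [N, h, lt_irrefl, if_false, mr]
    · exact if_pos h
  have hNM' {x : ℝ} (hx : x ≤ ℓ) : N' x = M' x := by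
    rcases hx.eq_or_lt with h | h
    · simp only [N', h, lt_irrefl, if_false, mr']
    · exact if_pos h
  have hN' (x : ℝ) (hx : 0 ≤ x) : HasDerivAt N' (q x * N x) x := by
    refine (hasDerivAt_ite_lt (f' := fun x => ((-k ^ 2 : ℝ) : ℂ) * M x)
      (fun x _ => hasDerivAt_sin_affine k (θ y) x) hR' mr' ?_ x).congr_deriv ?_
    · simp only [mr, hq.middle ℓ hq.length_nonneg le_rfl]
    · by_cases h : x < ℓ
      · rw [if_pos h, hNM h.le, hq.middle x hx h.le]
      · simp only [N, if_neg h]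
  have hM0 : M 0 = Real.cos (θ y) := by simp [M]
  have hM0' : M' 0 = -(k * Real.sin (θ y) : ℝ) := by simp [M']
  have lm : L 0 = N 0 := by
    rw [hNM hq.length_nonneg, hM0]
    simp [L, f3]
  have lm' : L' 0 = N' 0 := by
    rw [hNM' hq.length_nonneg, hM0']
    simp [L', f4]
  have hv : IsGlobalSolution q (fun x => if x < 0 then L x else N x)
      (fun x => if x < 0 then L' x else N' x) := by
    refine ⟨fun x => hasDerivAt_ite_lt (fun x _ => hL x) (fun x _ => hN x) lm lm' x, fun x => ?_⟩
    have := hasDerivAt_ite_lt (f := L') (g := N') (f' := fun x => q x * L x)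
      (g' := fun x => q x * N x) hL' hN' lm' (by rw [lm]) x
    rwa [← mul_ite] at this
  refine ⟨_, _, hv, ?_, ?_⟩
  · have i1 : IntegrableOn (fun x => Complex.normSq (if x < 0 then L x else N x)) (Iio 0) := by
      rw [← integrable_indicator_iff measurableSet_Ioi] at f5
      rw [← integrable_indicator_iff measurableSet_Iio]
      refine f5.comp_neg.congr (Filter.Eventually.of_forall fun x => ?_)
      by_cases hx : x < 0
      · simp [indicator, hx, L, Complex.normSq_ofReal, pow_two]
      · simp [indicator, hx]
    have i2 : IntegrableOn (fun x => Complex.normSq (if x < 0 then L x else N x)) (Icc 0 ℓ) :=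
      (Complex.continuous_normSq.comp hv.continuous).integrableOn_Icc
    have i3 : IntegrableOn (fun x => Complex.normSq (if x < 0 then L x else N x)) (Ioi ℓ) := by
      rw [← integrable_indicator_iff measurableSet_Ioi] at g5 ⊢
      refine ((g5.comp_sub_right ℓ).const_mul (ε ^ 2)).congr
        (Filter.Eventually.of_forall fun x => ?_)
      by_cases hx : ℓ < x
      · have h1 : ¬ x < 0 := not_lt.2 (hq.length_nonneg.trans hx.le)
        simp [indicator, hx, h1, N, R, hx.not_gt, Complex.normSq_ofReal, pow_two]
      · simp [indicator, hx]
    rw [← integrableOn_univ]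
    refine ((i1.union i2).union i3).mono_set fun x _ => ?_
    simp only [mem_union, mem_Iio, mem_Icc, mem_Ioi]
    rcases lt_or_ge x 0 with h | h
    · exact Or.inl (Or.inl h)
    · rcases le_or_gt x ℓ with h' | h'
      · exact Or.inl (Or.inr ⟨h, h'⟩)
      · exact Or.inr h'
  -- At `0` the glued solution has data `cos (θ y)` and `-k sin (θ y)`, which cannot both vanish.
  · by_contra hcon
    push Not at hcon
    have h0 := hcon 0
    have h1 := (hv.deriv_fst 0).unique
      ((hasDerivAt_const (0 : ℝ) (0 : ℂ)).congr_of_eventuallyEq (Filter.Eventually.of_forall hcon))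
    simp only [lt_irrefl, if_false] at h0 h1
    rw [hNM hq.length_nonneg, hM0, Complex.ofReal_eq_zero] at h0
    rw [hNM' hq.length_nonneg, hM0', neg_eq_zero, Complex.ofReal_eq_zero, mul_eq_zero] at h1
    have h2 := Real.sin_sq_add_cos_sq (θ y)
    rw [h0, h1.resolve_left hk.ne'] at h2
    norm_num at h2

end

/-! ### The quantization condition, simplicity and the numbering of eigenvalues. -/

theorem isBathtubCoeff_schrodingerCoeff {h m ℓ ωm ωp E : ℝ} (hh : 0 < h) (hm : 0 < m) (hℓ : 0 ≤ ℓ)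
    (hωm : 0 < ωm) (hωp : 0 < ωp) (hE : 0 < E) :
    IsBathtubCoeff (schrodingerCoeff h m (bathtubPotential m ℓ ωm ωp) E) ℓ
      (Real.sqrt (2 * m) * Real.sqrt E / h) (Real.sqrt (m * ωm / h)) (E / (2 * h * ωm))
      (Real.sqrt (m * ωp / h)) (E / (2 * h * ωp)) := by
  have hk2 : (Real.sqrt (2 * m) * Real.sqrt E / h) ^ 2 = 2 * m * E / h ^ 2 := by
    rw [div_pow, mul_pow, Real.sq_sqrt (by positivity), Real.sq_sqrt hE.le]
  have hα4 {ω : ℝ} (hω : 0 < ω) : Real.sqrt (m * ω / h) ^ 4 = (m * ω / h) ^ 2 := by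
    rw [show 4 = 2 * 2 from rfl, pow_mul, Real.sq_sqrt (by positivity)]
  have hf {ω : ℝ} (hω : 0 < ω) : 2 * Real.sqrt (m * ω / h) * Real.sqrt (E / (2 * h * ω)) =
      Real.sqrt (2 * m) * Real.sqrt E / h := by
    rw [← sq_eq_sq₀ (by positivity) (by positivity), hk2, mul_pow, mul_pow,
      Real.sq_sqrt (by positivity), Real.sq_sqrt (by positivity)]
    field_simp
  refine ⟨?_, hℓ, Real.sqrt_pos.2 (by positivity), by positivity, hf hωm,
    Real.sqrt_pos.2 (by positivity), by positivity, hf hωp, fun x hx => ?_, fun x hx hx' => ?_,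
    fun x hx => ?_⟩
  · have := continuous_bathtubPotential (m := m) (ωm := ωm) (ωp := ωp) hℓ
    unfold schrodingerCoeff
    fun_prop
  · rw [hα4 hωm, hk2]
    unfold schrodingerCoeff
    rw [bathtubPotential_eq hℓ, min_eq_left hx, max_eq_right (by linarith)]
    norm_cast
    field_simp
    ring
  · rw [hk2]
    unfold schrodingerCoeff
    rw [bathtubPotential_eq hℓ, min_eq_right hx, max_eq_right (by linarith)]
    norm_cast
    field_simp
    ring
  · rw [hα4 hωp, hk2]
    unfold schrodingerCoeff
    rw [bathtubPotential_eq hℓ, min_eq_right (by linarith), max_eq_left (by linarith)]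
    norm_cast
    field_simp
    ring

theorem isUnboundedEigenvalue_bathtubOp_iff {h m ℓ ωm ωp : ℝ} (hh : 0 < h) (hm : 0 < m)
    (hℓ : 0 ≤ ℓ) (hωm : 0 < ωm) (hωp : 0 < ωp) (E : ℂ) :
    IsUnboundedEigenvalue (bathtubOp h m ℓ ωm ωp) E ↔
      ∃ x : ℝ, E = (x : ℂ) ∧ 0 < x ∧ ∃ k : ℤ,
        quantizationPhase h m ℓ ωm ωp x = Real.pi * k := by
  have hV := continuous_bathtubPotential (m := m) (ωm := ωm) (ωp := ωp) hℓ
  have hphase (x : ℝ) : quantizationPhase h m ℓ ωm ωp x =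
      Real.sqrt (2 * m) * Real.sqrt x / h * ℓ + angleTheta (x / (2 * h * ωm)) +
        angleTheta (x / (2 * h * ωp)) := by
    unfold quantizationPhase
    ring
  constructor
  · intro hE
    obtain ⟨h1, h2⟩ := hE.real_pos hh hm hℓ hωm hωp
    refine ⟨E.re, h1, h2, ?_⟩
    rw [h1] at hE
    obtain ⟨v, v', hv, hi, hne⟩ :=
      (isUnboundedEigenvalue_schrodingerOp hh.ne' hm.ne' hV _).1 hE
    have hs := (isBathtubCoeff_schrodingerCoeff hh hm hℓ hωm hωp h2).sin_eq_zero angleTheta_spec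
      hv hi hne
    obtain ⟨n, hn⟩ := Real.sin_eq_zero_iff.1 hs
    exact ⟨n, by rw [hphase, ← hn, mul_comm]⟩
  · rintro ⟨x, rfl, hx, n, hn⟩
    refine (isUnboundedEigenvalue_schrodingerOp hh.ne' hm.ne' hV _).2
      ((isBathtubCoeff_schrodingerCoeff hh hm hℓ hωm hωp hx).exists_solution angleTheta_spec ?_)
    rw [← hphase, hn, mul_comm]
    exact Real.sin_int_mul_pi n

theorem finrank_unboundedEigenspace_bathtubOp {h m ℓ ωm ωp : ℝ} (hh : 0 < h) (hm : 0 < m)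
    (hℓ : 0 ≤ ℓ) (hωm : 0 < ωm) (hωp : 0 < ωp) {E : ℂ}
    (hE : IsUnboundedEigenvalue (bathtubOp h m ℓ ωm ωp) E) :
    Module.finrank ℂ (unboundedEigenspace (bathtubOp h m ℓ ωm ωp) E) = 1 := by
  have hV := continuous_bathtubPotential (m := m) (ωm := ωm) (ωp := ωp) hℓ
  obtain ⟨h1, h2⟩ := hE.real_pos hh hm hℓ hωm hωp
  generalize E.re = x at h1 h2
  subst h1
  have hq := isBathtubCoeff_schrodingerCoeff hh hm hℓ hωm hωp h2
  obtain ⟨u, hu, hne⟩ := (isUnboundedEigenvalue_iff _ _).1 hE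
  obtain ⟨v, v', hv, huv⟩ := (mem_unboundedEigenspace_schrodingerOp hh.ne' hm.ne' hV _ u).1 hu
  refine finrank_eq_one_iff'.2 ⟨⟨u, hu⟩, fun h0 => hne (congrArg Subtype.val h0), ?_⟩
  rintro ⟨w, hw⟩
  obtain ⟨f, f', hf, hwf⟩ := (mem_unboundedEigenspace_schrodingerOp hh.ne' hm.ne' hV _ w).1 hw
  obtain ⟨c, hc⟩ := hq.exists_eq_smul angleTheta_spec hv (integrable_normSq_of_ae_eq huv)
    ((L2R_ne_zero_iff huv hv.continuous).1 hne) hf (integrable_normSq_of_ae_eq hwf)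
  refine ⟨c, Subtype.ext (Lp.ext ?_)⟩
  filter_upwards [huv, hwf, Lp.coeFn_smul c u] with y e1 e2 e3
  change (c • u : L2R) y = w y
  rw [e3, Pi.smul_apply, e1, e2, smul_eq_mul, hc]

/-- This value fixes the numbering: each angle contributes `-π/2`, so the first multiple of `π` met
at positive energy is `0`. -/
theorem quantizationPhase_zero (h m ℓ ωm ωp : ℝ) :
    quantizationPhase h m ℓ ωm ωp 0 = -Real.pi := by
  simp only [quantizationPhase, zero_div, Real.sqrt_zero, mul_zero, angleTheta_spec.2.1]
  ring

theorem strictMonoOn_quantizationPhase {h m ℓ ωm ωp : ℝ} (hh : 0 < h) (hℓ : 0 ≤ ℓ)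
    (hωm : 0 < ωm) (hωp : 0 < ωp) : StrictMonoOn (quantizationPhase h m ℓ ωm ωp) (Ici 0) := by
  intro x hx y hy hxy
  have hx' : (0 : ℝ) ≤ x := hx
  have hy' : (0 : ℝ) ≤ y := hy
  have hθ {ω : ℝ} (hω : 0 < ω) : angleTheta (x / (2 * h * ω)) < angleTheta (y / (2 * h * ω)) :=
    angleTheta_spec.strictMonoOn (show 0 ≤ x / (2 * h * ω) by positivity)
      (show 0 ≤ y / (2 * h * ω) by positivity) (by gcongr)
  have : Real.sqrt (2 * m) * ℓ * Real.sqrt x / h ≤ Real.sqrt (2 * m) * ℓ * Real.sqrt y / h := by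
    gcongr
  unfold quantizationPhase
  linarith [hθ hωm, hθ hωp]

theorem continuousOn_quantizationPhase {h m ℓ ωm ωp : ℝ} (hh : 0 < h)
    (hωm : 0 < ωm) (hωp : 0 < ωp) : ContinuousOn (quantizationPhase h m ℓ ωm ωp) (Ici 0) := by
  have hθ {ω : ℝ} (hω : 0 < ω) : ContinuousOn (fun x => angleTheta (x / (2 * h * ω))) (Ici 0) := by
    refine angleTheta_spec.1.comp (by fun_prop) fun x hx => ?_
    have hx' : (0 : ℝ) ≤ x := hx
    exact (show 0 ≤ x / (2 * h * ω) by positivity)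
  have h1 : Continuous fun x => Real.sqrt (2 * m) * ℓ * Real.sqrt x / h := by fun_prop
  exact (h1.continuousOn.add (hθ hωm)).add (hθ hωp)

theorem tendsto_quantizationPhase {h m ℓ ωm ωp : ℝ} (hh : 0 < h) (hℓ : 0 ≤ ℓ)
    (hωm : 0 < ωm) (hωp : 0 < ωp) :
    Filter.Tendsto (quantizationPhase h m ℓ ωm ωp) Filter.atTop Filter.atTop := by
  have hθ {ω : ℝ} (hω : 0 < ω) :
      Filter.Tendsto (fun x => angleTheta (x / (2 * h * ω))) Filter.atTop Filter.atTop :=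
    angleTheta_spec.tendsto_atTop.comp (Filter.tendsto_id.atTop_div_const (by positivity))
  refine Filter.tendsto_atTop_mono (fun x => ?_) ((hθ hωm).atTop_add_atTop (hθ hωp))
  have : 0 ≤ Real.sqrt (2 * m) * ℓ * Real.sqrt x / h := by positivity
  unfold quantizationPhase
  linarith

theorem exists_enumeration_bathtubOp {h m ℓ ωm ωp : ℝ} (hh : 0 < h) (hm : 0 < m) (hℓ : 0 ≤ ℓ)
    (hωm : 0 < ωm) (hωp : 0 < ωp) :
    ∃ e : ℕ → ℝ, EnumeratesEigenvalues (bathtubOp h m ℓ ωm ωp) e ∧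
      ∀ n : ℕ, quantizationPhase h m ℓ ωm ωp (e n) = Real.pi * n := by
  have hmono := strictMonoOn_quantizationPhase (m := m) hh hℓ hωm hωp
  have hcont := continuousOn_quantizationPhase (m := m) (ℓ := ℓ) hh hωm hωp
  have hzero := quantizationPhase_zero h m ℓ ωm ωp
  have hex (n : ℕ) : ∃ x : ℝ, 0 < x ∧ quantizationPhase h m ℓ ωm ωp x = Real.pi * n := by
    obtain ⟨X, hX, hX0⟩ := (((tendsto_quantizationPhase (m := m) hh hℓ hωm hωp).eventually_ge_atTop
      (Real.pi * n)).and (Filter.eventually_ge_atTop 0)).exists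
    have hn : 0 ≤ Real.pi * n := by positivity
    obtain ⟨x, hx, hxn⟩ := intermediate_value_Icc hX0 (hcont.mono Icc_subset_Ici_self)
      (show Real.pi * n ∈ Icc _ _ from ⟨by rw [hzero]; linarith [Real.pi_pos], hX⟩)
    refine ⟨x, lt_of_le_of_ne hx.1 ?_, hxn⟩
    rintro rfl
    rw [hzero] at hxn
    linarith [Real.pi_pos]
  choose e he0 he using hex
  refine ⟨e, ⟨fun n k hnk => ?_, fun E => ?_⟩, he⟩
  · rw [← hmono.lt_iff_lt (show (0 : ℝ) ≤ e n from (he0 n).le) (show (0 : ℝ) ≤ e k from (he0 k).le),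
      he, he]
    have : (n : ℝ) < k := by exact_mod_cast hnk
    gcongr
  · rw [isUnboundedEigenvalue_bathtubOp_iff hh hm hℓ hωm hωp]
    constructor
    · rintro ⟨x, rfl, hx, k, hk⟩
      have h1 : quantizationPhase h m ℓ ωm ωp 0 < quantizationPhase h m ℓ ωm ωp x :=
        hmono self_mem_Ici (show (0 : ℝ) ≤ x from hx.le) hx
      rw [hzero, hk] at h1
      -- The level `k = -1` belongs to `E = 0` and is excluded by strict monotonicity, so the list
      -- starts at `k = 0`.
      have h2 : (-1 : ℝ) < k := by
        by_contra hcon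
        push Not at hcon
        nlinarith [Real.pi_pos]
      have h3 : 0 ≤ k := by
        have : (-1 : ℤ) < k := by exact_mod_cast h2
        omega
      lift k to ℕ using h3
      refine ⟨k, ?_⟩
      congr 1
      refine hmono.injOn (show (0 : ℝ) ≤ x from hx.le) (show (0 : ℝ) ≤ e k from (he0 k).le) ?_
      rw [hk, he]
      simp
    · rintro ⟨n, rfl⟩
      exact ⟨e n, rfl, he0 n, n, by rw [he]; simp⟩

/-- A strictly increasing sequence is determined by its range, so the phase formula for one
enumeration holds for every enumeration. -/
theorem EnumeratesEigenvalues.eq {H : Type*} [AddCommGroup H] [Module ℂ H] {A : H →ₗ.[ℂ] H}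
    {e f : ℕ → ℝ} (he : EnumeratesEigenvalues A e) (hf : EnumeratesEigenvalues A f) : e = f := by
  refine (StrictMono.range_inj he.1 hf.1).1 (Set.ext fun x => ?_)
  have h1 := (he.2 x).symm.trans (hf.2 x)
  simp only [Complex.ofReal_inj] at h1
  simpa only [mem_range, eq_comm] using h1

theorem theorem1 (h m ℓ ωm ωp : ℝ) (hh : 0 < h) (hm : 0 < m) (hℓ : 0 ≤ ℓ)
    (hωm : 0 < ωm) (hωp : 0 < ωp) (hne : ℓ = 0 → ωm ≠ ωp) :
    (∀ E : ℂ, IsUnboundedEigenvalue (bathtubOp h m ℓ ωm ωp) E ↔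
      ∃ x : ℝ, E = (x : ℂ) ∧ 0 < x ∧ ∃ k : ℤ,
        quantizationPhase h m ℓ ωm ωp x = Real.pi * k) ∧
    (∀ E : ℂ, IsUnboundedEigenvalue (bathtubOp h m ℓ ωm ωp) E →
      Module.finrank ℂ (unboundedEigenspace (bathtubOp h m ℓ ωm ωp) E) = 1) ∧
    (∃ e : ℕ → ℝ, EnumeratesEigenvalues (bathtubOp h m ℓ ωm ωp) e) ∧
    (∀ e : ℕ → ℝ, EnumeratesEigenvalues (bathtubOp h m ℓ ωm ωp) e →
      ∀ n : ℕ, quantizationPhase h m ℓ ωm ωp (e n) = Real.pi * n) := by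
  obtain ⟨e, he, hphase⟩ := exists_enumeration_bathtubOp hh hm hℓ hωm hωp
  refine ⟨isUnboundedEigenvalue_bathtubOp_iff hh hm hℓ hωm hωp,
    fun E hE => finrank_unboundedEigenspace_bathtubOp hh hm hℓ hωm hωp hE, ⟨e, he⟩, fun f hf => ?_⟩
  rw [hf.eq he]
  exact hphase
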